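/- Two players play the following game on a finite connected graph $H$. The robber starts at a vertex of his choice, unknown to the cop. In each round the robber first stays where he is or moves to an adjacent vertex; then the cop probes any vertex of $H$ and is told the distance in $H$ from that vertex to the robber's current location. The choice of a probe may depend on the results of the previous ones. The cop wins as soon as the results of the probes made so far determine the robber's current location. The graph $H$ is called locatable if the cop has a strategy that guarantees a win within a bounded number of rounds. For a graph $G$ and an integer $m\ge 1$, let $G^{1/m}$ be the graph obtained from $G$ by replacing each edge by a path of length $m$ through new vertices. A matching of $G$ is maximal if it is not properly contained in another matching of $G$. Let $G$ be a finite connected graph with a maximal matching of size $k$. If $m\ge k+1$ and $m\ge 12$, then $G^{1/m}$ is locatable. The bound $m\ge k+1$ is best possible: for every $k\ge 1$, the complete graph $K_{2k+1}$ has a maximal matching of size $k$, but $K_{2k+1}^{1/k}$ is not locatable. -/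

import Mathlib

namespace RobberLocating

universe u

/-! ### Equal-length subdivisions -/

/-- The vertices of the subdivision of `G` with threads of length `m`: the vertices of `G`
(the branch vertices), and `m - 1` new vertices for each edge of `G`. -/
abbrev SubdivVertex {V : Type u} (G : SimpleGraph V) (m : ℕ) : Type u :=
  V ⊕ (G.edgeSet × Fin (m - 1))

/-- For an edge `e` of `G`, the vertices `threadVertex G m e 0, …, threadVertex G m e m` are the
successive vertices of the path of length `m` that replaces `e`. The end at which the numbering
starts is chosen arbitrarily for each edge. -/
noncomputable def threadVertex {V : Type u} (G : SimpleGraph V) (m : ℕ) (e : G.edgeSet) (i : ℕ) :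
    SubdivVertex G m :=
  if i = 0 then Sum.inl (Quot.out (e : Sym2 V)).1
  else if h : i - 1 < m - 1 then Sum.inr (e, ⟨i - 1, h⟩)
  else Sum.inl (Quot.out (e : Sym2 V)).2

/-- The graph obtained from `G` by replacing each edge by a path of length `m` through new
vertices (for `m ≥ 1`). -/
noncomputable def subdivision {V : Type u} (G : SimpleGraph V) (m : ℕ) :
    SimpleGraph (SubdivVertex G m) :=
  SimpleGraph.fromRel fun x y =>
    ∃ (e : G.edgeSet) (i : ℕ), i < m ∧ x = threadVertex G m e i ∧ y = threadVertex G m e (i + 1)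

/-! ### The Robber Locating game -/

/-- A possible behaviour of the robber: he starts at the vertex `w 0`, and in round `n + 1` he
stays where he is or moves to an adjacent vertex, so that he is at `w (n + 1)` when the cop makes
her probe of that round. -/
def IsTrajectory {V : Type u} (G : SimpleGraph V) (w : ℕ → V) : Prop :=
  ∀ n, w (n + 1) = w n ∨ G.Adj (w n) (w (n + 1))

/-- A strategy of the cop: the next vertex to probe, as a function of the list of the results of
the probes made so far (the most recent result first). -/
abbrev Strategy (V : Type u) : Type u := List ℕ → V

/-- The results of the first `n` probes (the most recent one first) when the cop plays `σ` and
the robber's trajectory is `w`. The result of a probe is the distance in `G` from the vertex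
probed to the current location of the robber. -/
noncomputable def results {V : Type u} (G : SimpleGraph V) (σ : Strategy V) (w : ℕ → V) :
    ℕ → List ℕ
  | 0 => []
  | n + 1 => G.dist (σ (results G σ w n)) (w (n + 1)) :: results G σ w n

/-- After `n` rounds in which the cop plays `σ` and the robber follows `w`, the results of the
probes so far determine the robber's current location. -/
def IsLocatedAt {V : Type u} (G : SimpleGraph V) (σ : Strategy V) (w : ℕ → V) (n : ℕ) : Prop :=
  ∀ w' : ℕ → V, IsTrajectory G w' → results G σ w' n = results G σ w n → w' n = w n

/-- A connected graph is locatable if the cop has a strategy that is guaranteed to win in bounded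
time: for some `N`, whatever the robber does, there is a round, among the first `N`, in which
the cop determines his current location. -/
def Locatable {V : Type u} (G : SimpleGraph V) : Prop :=
  ∃ (σ : Strategy V) (N : ℕ), ∀ w : ℕ → V, IsTrajectory G w →
    ∃ n, 1 ≤ n ∧ n ≤ N ∧ IsLocatedAt G σ w n

/-! ### Maximal matchings -/

/-- A matching of `G` that is maximal, that is, not properly contained in another matching. -/
def IsMaximalMatching {V : Type u} {G : SimpleGraph V} (M : G.Subgraph) : Prop :=
  Maximal (fun M' : G.Subgraph => M'.IsMatching) M

end RobberLocating

/-!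
# Locatability of subdivided graphs

The cop keeps track of the set of the robber's candidate locations; she has a winning strategy
exactly when she can make this set a singleton in a bounded number of rounds (`CopWins`,
`locatable_of_winsIn`, `Locatable.exists_winsIn`). The points of the subdivision are written
`pt G m s z f`, the point at distance `f` from the vertex `s` on the thread that replaces the edge
`sz`, and the result of a probe at a vertex of `G`, or on another thread, is a minimum of two or
four numbers (`dist_inl_pt`, `dist_pt_pt`). Modulo `m` it tells `f` up to a few alternatives.

*The upper bound.* A thread with a known end is harmless: probes at that end give the exact
position, and the possible other ends are excluded one at a time (`copWins_knownEnd`); so is a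
thread with both ends in a set on which the cop wins (`copWins_ends`). The difficulty is a robber
who leaves a set `S` of candidate vertices on which she wins, for an unknown vertex outside `S`.
The edges of the maximal matching serve as tests. A probe in the middle of the thread of a matching
edge `ab` finds a robber who heads for `a` or `b`, with his distance from the vertex that he left
(`copWins_twoEnds`), and otherwise rules out both of these vertices. It takes at least `m` rounds
to cross a thread, and there are at most `k ≤ m - 1` edges to test, so all the tests can be made in
time; as the vertices outside the matching are independent, the robber is then known to be on a
thread of a harmless kind. The delicate point is that results near the ends of a thread are
ambiguous modulo `m`. There the probes are made at vertices, or off the middle of a thread, and the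
count of rounds is just sufficient (`copWins_near`, `copWins_nearEnds`, `copWins_crossing`).

The cop thus wins on larger and larger sets of vertices. On sets of unmatched vertices, she
probes a matched vertex that distinguishes the candidates; where there is none, the candidates have
the same neighbours, and one test is saved (`copWins_twins`, `copWins_unmatched`). The matched
vertices are then added one edge `e` at a time, with a first probe inside the thread of `e`
(`copWins_insert`). At last the set consists of all the vertices, and one probe reduces the
initial position to that case (`copWins_univ`).

*The lower bound.* On the subdivided complete graph, two candidates among the original vertices
suffice for the robber to escape for ever. He stays there until a probe is made on a thread at one
of these vertices, `u` say, and then sets off from `u`. All the threads `uz` that no probed thread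
meets look alike, each probe spoils at most two of them, and the first one only one besides `u`; so
two candidate vertices are left on arrival, where `u` itself serves as one of these if he may have
turned back halfway unnoticed (`not_winsIn_top`).
-/

namespace RobberLocating

universe u

/-! ### The game in terms of sets of candidate locations -/

/-- The locations that the robber may occupy if he was in `S`, has then made his move, and the
probe at `p` has given `d`. -/
def update {V : Type u} (H : SimpleGraph V) (S : Set V) (p : V) (d : ℕ) : Set V :=
  {y | (∃ x ∈ S, y = x ∨ H.Adj x y) ∧ H.dist p y = d}

/-- The cop, knowing only that the robber is in `S`, can locate him within `n` more rounds. -/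
def WinsIn {V : Type u} (H : SimpleGraph V) : ℕ → Set V → Prop
  | 0, S => S.Subsingleton
  | n + 1, S => S.Subsingleton ∨ ∃ p, ∀ d, WinsIn H n (update H S p d)

/-- The locations consistent with a list of results (the most recent one first) when the cop
plays `σ`. -/
def possible {V : Type u} (H : SimpleGraph V) (σ : Strategy V) : List ℕ → Set V
  | [] => Set.univ
  | d :: l => update H (possible H σ l) (σ l) d

theorem update_mono {V : Type u} {H : SimpleGraph V} {S T : Set V} (h : S ⊆ T) (p : V) (d : ℕ) :
    update H S p d ⊆ update H T p d :=
  fun _ ⟨⟨x, hx, hxy⟩, hd⟩ => ⟨⟨x, h hx, hxy⟩, hd⟩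

theorem WinsIn.mono {V : Type u} {H : SimpleGraph V} {n : ℕ} {S T : Set V} (h : S ⊆ T)
    (hT : WinsIn H n T) : WinsIn H n S := by
  induction n generalizing S T with
  | zero => exact Set.Subsingleton.anti hT h
  | succ n ih =>
    rcases hT with hT | ⟨p, hp⟩
    · exact Or.inl (hT.anti h)
    · exact Or.inr ⟨p, fun d => ih (update_mono h p d) (hp d)⟩

theorem WinsIn.of_subsingleton {V : Type u} {H : SimpleGraph V} {S : Set V}
    (h : S.Subsingleton) (n : ℕ) : WinsIn H n S := by
  cases n with
  | zero => exact h
  | succ n => exact Or.inl h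

theorem WinsIn.mono_left {V : Type u} {H : SimpleGraph V} {n k : ℕ} {S : Set V}
    (hnk : n ≤ k) (h : WinsIn H n S) : WinsIn H k S := by
  induction n generalizing k S with
  | zero => exact WinsIn.of_subsingleton h k
  | succ n ih =>
    obtain ⟨k, rfl⟩ : ∃ k', k = k' + 1 := ⟨k - 1, by omega⟩
    rcases h with h | ⟨p, hp⟩
    · exact Or.inl h
    · exact Or.inr ⟨p, fun d => ih (by omega) (hp d)⟩

theorem length_results {V : Type u} (H : SimpleGraph V) (σ : Strategy V) (w : ℕ → V) (n : ℕ) :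
    (results H σ w n).length = n := by
  induction n with
  | zero => rfl
  | succ n ih => simp [results, ih]

theorem results_congr {V : Type u} (H : SimpleGraph V) (σ : Strategy V) {w w' : ℕ → V} {n : ℕ}
    (h : ∀ i ≤ n, w i = w' i) : results H σ w n = results H σ w' n := by
  induction n with
  | zero => rfl
  | succ n ih => simp only [results, ih fun i hi => h i (by omega), h (n + 1) le_rfl]

theorem results_suffix {V : Type u} (H : SimpleGraph V) (σ : Strategy V) (w : ℕ → V) {i n : ℕ}
    (h : i ≤ n) : results H σ w i <:+ results H σ w n := by
  induction n with
  | zero =>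
    obtain rfl : i = 0 := by omega
    exact List.suffix_rfl
  | succ n ih =>
    rcases Nat.lt_or_ge n i with hi | hi
    · obtain rfl : i = n + 1 := by omega
      exact List.suffix_rfl
    · exact (ih hi).trans (List.suffix_cons _ _)

/-- A candidate is the end of some trajectory that fits the results: as only the past of
the robber is constrained, he may be taken to stay put from then on. -/
theorem mem_possible {V : Type u} {H : SimpleGraph V} {σ : Strategy V} {l : List ℕ} {y : V} :
    y ∈ possible H σ l ↔
      ∃ w, IsTrajectory H w ∧ results H σ w l.length = l ∧ w l.length = y := by
  induction l generalizing y with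
  | nil => exact ⟨fun _ => ⟨fun _ => y, fun _ => Or.inl rfl, rfl, rfl⟩, fun _ => trivial⟩
  | cons d l ih =>
    constructor
    · rintro ⟨⟨x, hx, hxy⟩, hd⟩
      obtain ⟨w, hw, hres, rfl⟩ := ih.1 hx
      have hcongr : ∀ i ≤ l.length, (fun n => if n ≤ l.length then w n else y) i = w i :=
        fun i hi => if_pos hi
      refine ⟨fun n => if n ≤ l.length then w n else y, fun n => ?_, ?_, ?_⟩
      · rcases Nat.lt_trichotomy n l.length with h | h | h
        · simpa [h.le, Nat.succ_le_of_lt h] using hw n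
        · subst h
          simpa using hxy
        · simp [Nat.not_le.2 h, show ¬ n + 1 ≤ l.length by omega]
      · simp only [List.length_cons, results, results_congr H σ hcongr, hres]
        simp [hd]
      · simp
    · rintro ⟨w, hw, hres, rfl⟩
      simp only [List.length_cons, results, List.cons.injEq] at hres
      refine ⟨⟨w l.length, ih.2 ⟨w, hw, hres.2, rfl⟩, hw l.length⟩, ?_⟩
      rw [← hres.1, hres.2, List.length_cons]

theorem isLocatedAt_iff {V : Type u} {H : SimpleGraph V} {σ : Strategy V} {w : ℕ → V} {n : ℕ}
    (hw : IsTrajectory H w) :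
    IsLocatedAt H σ w n ↔ (possible H σ (results H σ w n)).Subsingleton := by
  have hlen := length_results H σ w n
  constructor
  · intro h
    have key : ∀ y ∈ possible H σ (results H σ w n), y = w n := by
      intro y hy
      obtain ⟨w', hw', hres, rfl⟩ := mem_possible.1 hy
      rw [hlen] at hres ⊢
      exact h w' hw' hres
    exact fun x hx y hy => (key x hx).trans (key y hy).symm
  · intro h w' hw' hres
    exact h (mem_possible.2 ⟨w', hw', by rw [hlen, hres], by rw [hlen]⟩)
      (mem_possible.2 ⟨w, hw, by rw [hlen], by rw [hlen]⟩)

/-- A strategy may depend on the past only through the set of candidates and the number of rounds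
left, so it suffices to choose a good probe for each of these. -/
theorem locatable_of_winsIn {V : Type u} [Nonempty V] {H : SimpleGraph V} {N : ℕ}
    (h : WinsIn H N Set.univ) : Locatable H := by
  classical
  have hπ : ∀ (n : ℕ) (S : Set V), ∃ p, WinsIn H (n + 1) S → S.Subsingleton ∨
      ∀ d, WinsIn H n (update H S p d) := by
    intro n S
    by_cases hn : WinsIn H (n + 1) S
    · rcases hn with hs | ⟨p, hp⟩
      · exact ⟨Classical.arbitrary V, fun _ => Or.inl hs⟩
      · exact ⟨p, fun _ => Or.inr hp⟩
    · exact ⟨Classical.arbitrary V, fun h => absurd h hn⟩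
  choose π hπ using hπ
  let K : List ℕ → Set V := fun l => List.rec Set.univ
    (fun d l S => update H S (π (N - 1 - l.length) S) d) l
  let σ : Strategy V := fun l => π (N - 1 - l.length) (K l)
  have hK : ∀ l, possible H σ l = K l := by
    intro l
    induction l with
    | nil => rfl
    | cons d l ih => exact congrArg (fun S => update H S (σ l) d) ih
  refine ⟨σ, N + 1, fun w hw => ?_⟩
  have key : ∀ n ≤ N, (∃ i ≤ n, (possible H σ (results H σ w i)).Subsingleton) ∨
      WinsIn H (N - n) (possible H σ (results H σ w n)) := by
    intro n
    induction n with
    | zero => exact fun _ => Or.inr h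
    | succ n ih =>
      intro hn
      rcases ih (by omega) with ⟨i, hi, hs⟩ | hwin
      · exact Or.inl ⟨i, by omega, hs⟩
      · rw [show N - n = N - (n + 1) + 1 by omega] at hwin
        rcases hπ _ _ hwin with hs | hnext
        · exact Or.inl ⟨n, by omega, hs⟩
        · right
          have hσ : σ (results H σ w n) =
              π (N - (n + 1)) (possible H σ (results H σ w n)) := by
            rw [hK]
            simp only [σ, length_results, show N - 1 - n = N - (n + 1) by omega]
          have := hnext (H.dist (σ (results H σ w n)) (w (n + 1)))
          rw [← hσ] at this
          exact this
  obtain ⟨i, hi, hs⟩ : ∃ i ≤ N, (possible H σ (results H σ w i)).Subsingleton := by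
    rcases key N le_rfl with h | h
    · exact h
    · exact ⟨N, le_rfl, by simpa [WinsIn] using h⟩
  rcases Nat.eq_zero_or_pos i with rfl | hpos
  · refine ⟨1, le_rfl, by omega, (isLocatedAt_iff hw).2 ?_⟩
    exact fun x _ y _ => hs (Set.mem_univ x) (Set.mem_univ y)
  · exact ⟨i, hpos, by omega, (isLocatedAt_iff hw).2 hs⟩

/-- Results that do not occur lead to an empty set of candidates, so a strategy that wins against
each trajectory wins against each set of candidates. -/
theorem Locatable.exists_winsIn {V : Type u} {H : SimpleGraph V} (h : Locatable H) :
    ∃ N, WinsIn H N Set.univ := by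
  obtain ⟨σ, N, h⟩ := h
  refine ⟨N, ?_⟩
  have key : ∀ n (l : List ℕ), l.length + n = N →
      (∀ l', l' <:+ l → 1 ≤ l'.length → ¬ (possible H σ l').Subsingleton) →
      WinsIn H n (possible H σ l) := by
    intro n
    induction n with
    | zero =>
      intro l hl hsuf
      rcases (possible H σ l).eq_empty_or_nonempty with he | ⟨y, hy⟩
      · rw [he]
        exact Set.subsingleton_empty
      · obtain ⟨w, hw, hres, -⟩ := mem_possible.1 hy
        obtain ⟨i, hi1, hiN, hloc⟩ := h w hw
        refine absurd ((isLocatedAt_iff hw).1 hloc) (hsuf _ ?_ ?_)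
        · rw [← hres]
          exact results_suffix H σ w (by omega)
        · rwa [length_results]
    | succ n ih =>
      intro l hl hsuf
      refine Or.inr ⟨σ l, fun d => ?_⟩
      by_cases hs : (possible H σ (d :: l)).Subsingleton
      · exact WinsIn.of_subsingleton hs n
      · refine ih (d :: l) (by simp only [List.length_cons]; omega) fun l' hl' h1 => ?_
        rcases List.suffix_cons_iff.1 hl' with rfl | hl'
        · exact hs
        · exact hsuf l' hl' h1
  refine key N [] (by simp) fun l' hl' h1 => ?_
  rw [List.suffix_nil.1 hl'] at h1
  simp at h1

/-- The cop, knowing only that the robber is in `S`, can locate him in a bounded number of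
rounds. -/
def CopWins {V : Type u} (H : SimpleGraph V) (S : Set V) : Prop := ∃ n, WinsIn H n S

theorem CopWins.mono {V : Type u} {H : SimpleGraph V} {S T : Set V} (hT : CopWins H T)
    (h : S ⊆ T) : CopWins H S :=
  hT.imp fun _ hn => hn.mono h

theorem CopWins.of_subsingleton {V : Type u} {H : SimpleGraph V} {S : Set V}
    (h : S.Subsingleton) : CopWins H S := ⟨0, h⟩

theorem CopWins.probe {V : Type u} [Finite V] {H : SimpleGraph V} {S : Set V} (p : V)
    (h : ∀ d, CopWins H (update H S p d)) : CopWins H S := by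
  choose n hn using h
  obtain ⟨N, hN⟩ : ∃ N, ∀ y, n (H.dist p y) ≤ N :=
    (Set.finite_range fun y => n (H.dist p y)).bddAbove.imp fun N hN y => hN ⟨y, rfl⟩
  refine ⟨N + 1, Or.inr ⟨p, fun d => ?_⟩⟩
  rcases (update H S p d).eq_empty_or_nonempty with he | ⟨y, hy⟩
  · rw [he]
    exact WinsIn.of_subsingleton Set.subsingleton_empty N
  · obtain ⟨-, rfl⟩ := hy
    exact (hn _).mono_left (hN y)

/-! ### Points of a subdivision and their distances -/

section Points

variable {V : Type u} {G : SimpleGraph V} {m : ℕ}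

open Classical in
/-- The point at distance `f` from `s` on the thread that replaces the edge from `s` to `z`
(for `f ≤ m`). The value is `s` if there is no such edge. -/
noncomputable def pt (G : SimpleGraph V) (m : ℕ) (s z : V) (f : ℕ) : SubdivVertex G m :=
  if h : G.Adj s z then
    if (Quot.out s(s, z)).1 = s then threadVertex G m ⟨s(s, z), h⟩ f
    else threadVertex G m ⟨s(s, z), h⟩ (m - f)
  else Sum.inl s

theorem out_eq (s z : V) :
    ((Quot.out s(s, z)).1 = s ∧ (Quot.out s(s, z)).2 = z) ∨
      ((Quot.out s(s, z)).1 = z ∧ (Quot.out s(s, z)).2 = s) := by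
  have h : s((Quot.out s(s, z)).1, (Quot.out s(s, z)).2) = s(s, z) := Quot.out_eq _
  simpa [Prod.ext_iff] using h

theorem threadVertex_zero (e : G.edgeSet) :
    threadVertex G m e 0 = Sum.inl (Quot.out (e : Sym2 V)).1 := by
  simp [threadVertex]

theorem threadVertex_self (hm : 1 ≤ m) (e : G.edgeSet) :
    threadVertex G m e m = Sum.inl (Quot.out (e : Sym2 V)).2 := by
  rw [threadVertex, if_neg (by omega), dif_neg (by omega)]

theorem pt_zero (hm : 1 ≤ m) (s z : V) : pt G m s z 0 = Sum.inl s := by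
  unfold pt
  split_ifs with h h1
  · rw [threadVertex_zero, h1]
  · rw [Nat.sub_zero, threadVertex_self hm]
    rcases out_eq s z with h2 | h2
    · exact absurd h2.1 h1
    · exact congrArg _ h2.2
  · rfl

theorem pt_comm {s z : V} (h : G.Adj s z) {f : ℕ} (hf : f ≤ m) :
    pt G m s z f = pt G m z s (m - f) := by
  have he : (⟨s(s, z), h⟩ : G.edgeSet) = ⟨s(z, s), h.symm⟩ := Subtype.ext Sym2.eq_swap
  have hne := h.ne
  have h2 : Quot.out s(z, s) = Quot.out s(s, z) := by rw [Sym2.eq_swap]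
  unfold pt
  rw [dif_pos h, dif_pos h.symm, h2, he]
  rcases out_eq s z with h1 | h1
  · rw [if_pos h1.1, if_neg (by rw [h1.1]; exact hne), Nat.sub_sub_self hf]
  · rw [if_neg (by rw [h1.1]; exact hne.symm), if_pos h1.1]

theorem pt_self (hm : 1 ≤ m) {s z : V} (h : G.Adj s z) : pt G m s z m = Sum.inl z := by
  rw [pt_comm h le_rfl, Nat.sub_self, pt_zero hm]

theorem threadVertex_eq_pt (e : G.edgeSet) (f : ℕ) :
    threadVertex G m e f = pt G m (Quot.out (e : Sym2 V)).1 (Quot.out (e : Sym2 V)).2 f := by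
  obtain ⟨e, he⟩ := e
  have h : s((Quot.out e).1, (Quot.out e).2) = e := Quot.out_eq e
  have hadj : G.Adj (Quot.out e).1 (Quot.out e).2 := by
    rw [← SimpleGraph.mem_edgeSet, h]
    exact he
  unfold pt
  rw [dif_pos hadj]
  simp [h]

theorem adj_out (e : G.edgeSet) :
    G.Adj (Quot.out (e : Sym2 V)).1 (Quot.out (e : Sym2 V)).2 := by
  rw [← SimpleGraph.mem_edgeSet]
  exact (congrArg (· ∈ G.edgeSet) (Quot.out_eq (e : Sym2 V))).mpr e.2

/-- A thread vertex is a point of the thread, in either orientation. -/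
theorem exists_threadVertex {s z : V} (h : G.Adj s z) :
    ∃ e : G.edgeSet,
      ((Quot.out (e : Sym2 V)).1 = s ∧ (Quot.out (e : Sym2 V)).2 = z ∧
        ∀ f, pt G m s z f = threadVertex G m e f) ∨
      ((Quot.out (e : Sym2 V)).1 = z ∧ (Quot.out (e : Sym2 V)).2 = s ∧
        ∀ f, pt G m s z f = threadVertex G m e (m - f)) := by
  refine ⟨⟨s(s, z), h⟩, ?_⟩
  rcases out_eq s z with h1 | h1
  · exact Or.inl ⟨h1.1, h1.2, fun f => by rw [pt, dif_pos h, if_pos h1.1]⟩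
  · refine Or.inr ⟨h1.1, h1.2, fun f => ?_⟩
    rw [pt, dif_pos h, if_neg (by rw [h1.1]; exact h.ne.symm)]

theorem exists_eq_pt (hm : 1 ≤ m) (x : SubdivVertex G m) :
    (∃ v, x = Sum.inl v) ∨ ∃ s z f, G.Adj s z ∧ 0 < f ∧ f < m ∧ x = pt G m s z f := by
  rcases x with v | ⟨e, i⟩
  · exact Or.inl ⟨v, rfl⟩
  · refine Or.inr ⟨_, _, i + 1, adj_out e, by omega, by omega, ?_⟩
    rw [← threadVertex_eq_pt, threadVertex, if_neg (by omega), dif_pos (by omega)]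
    rfl

theorem threadVertex_interior {e : G.edgeSet} {i : ℕ} (h0 : 0 < i) (hi : i < m) :
    threadVertex G m e i = Sum.inr (e, ⟨i - 1, by omega⟩) := by
  rw [threadVertex, if_neg (by omega), dif_pos (by omega)]

theorem subdivision_adj_threadVertex (hm : 1 ≤ m) (e : G.edgeSet) {i : ℕ} (hi : i < m) :
    (subdivision G m).Adj (threadVertex G m e i) (threadVertex G m e (i + 1)) := by
  refine (SimpleGraph.fromRel_adj _ _ _).2 ⟨?_, Or.inl ⟨e, i, hi, rfl, rfl⟩⟩
  have hne := (adj_out e).ne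
  rcases Nat.eq_zero_or_pos i with rfl | h0
  · rw [threadVertex_zero]
    rcases Nat.lt_or_ge 1 m with h1 | h1
    · rw [threadVertex_interior (by omega) (by omega)]
      simp
    · obtain rfl : m = 1 := by omega
      rw [threadVertex_self le_rfl]
      simpa using hne
  · rw [threadVertex_interior h0 hi]
    rcases Nat.lt_or_ge (i + 1) m with h1 | h1
    · rw [threadVertex_interior (by omega) h1]
      simp
      omega
    · obtain rfl : m = i + 1 := by omega
      rw [threadVertex_self hm]
      simp

theorem subdivision_adj_pt (hm : 1 ≤ m) {s z : V} (h : G.Adj s z) {f : ℕ} (hf : f < m) :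
    (subdivision G m).Adj (pt G m s z f) (pt G m s z (f + 1)) := by
  obtain ⟨e, ⟨-, -, he⟩ | ⟨-, -, he⟩⟩ := exists_threadVertex (m := m) h
  · rw [he, he]
    exact subdivision_adj_threadVertex hm e hf
  · rw [he, he, show m - f = m - (f + 1) + 1 by omega]
    exact (subdivision_adj_threadVertex hm e (by omega)).symm

theorem exists_of_subdivision_adj {x y : SubdivVertex G m} (h : (subdivision G m).Adj x y) :
    ∃ s z f, G.Adj s z ∧ f < m ∧ x = pt G m s z f ∧ y = pt G m s z (f + 1) := by
  rcases ((SimpleGraph.fromRel_adj _ _ _).1 h).2 with ⟨e, i, hi, rfl, rfl⟩ | ⟨e, i, hi, rfl, rfl⟩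
  · exact ⟨_, _, i, adj_out e, hi, threadVertex_eq_pt _ _, threadVertex_eq_pt _ _⟩
  · refine ⟨_, _, m - (i + 1), (adj_out e).symm, by omega, ?_, ?_⟩
    · rw [← pt_comm (adj_out e) (by omega), threadVertex_eq_pt]
    · rw [show m - (i + 1) + 1 = m - i by omega, ← pt_comm (adj_out e) (by omega),
        threadVertex_eq_pt]

theorem pt_eq_inl_iff (hm : 1 ≤ m) {s z v : V} (h : G.Adj s z) {f : ℕ} (hf : f ≤ m) :
    pt G m s z f = Sum.inl v ↔ (f = 0 ∧ v = s) ∨ (f = m ∧ v = z) := by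
  constructor
  · intro hv
    rcases Nat.eq_zero_or_pos f with rfl | h0
    · rw [pt_zero hm] at hv
      exact Or.inl ⟨rfl, (Sum.inl.inj hv).symm⟩
    rcases Nat.lt_or_ge f m with h1 | h1
    · obtain ⟨e, ⟨-, -, he⟩ | ⟨-, -, he⟩⟩ := exists_threadVertex (m := m) h
      · rw [he, threadVertex_interior h0 h1] at hv
        exact absurd hv (by simp)
      · rw [he, threadVertex_interior (by omega) (by omega)] at hv
        exact absurd hv (by simp)
    · obtain rfl : f = m := by omega
      rw [pt_self hm h] at hv
      exact Or.inr ⟨rfl, (Sum.inl.inj hv).symm⟩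
  · rintro (⟨rfl, rfl⟩ | ⟨rfl, rfl⟩)
    · exact pt_zero hm _ _
    · exact pt_self hm h

theorem pt_inj (hm : 1 ≤ m) {s z s' z' : V} (h : G.Adj s z) (h' : G.Adj s' z') {f f' : ℕ}
    (h0 : 0 < f) (h1 : f < m) (hf' : f' ≤ m) (heq : pt G m s z f = pt G m s' z' f') :
    (s' = s ∧ z' = z ∧ f' = f) ∨ (s' = z ∧ z' = s ∧ f' = m - f) := by
  have h0' : 0 < f' := by
    rcases Nat.eq_zero_or_pos f' with rfl | h0'
    · rw [pt_zero hm, pt_eq_inl_iff hm h h1.le] at heq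
      omega
    · exact h0'
  have h1' : f' < m := by
    rcases Nat.lt_or_ge f' m with h1' | h1'
    · exact h1'
    · obtain rfl : f' = m := by omega
      rw [pt_self hm h', pt_eq_inl_iff hm h h1.le] at heq
      omega
  obtain ⟨e, he⟩ := exists_threadVertex (m := m) h
  obtain ⟨e', he'⟩ := exists_threadVertex (m := m) h'
  rcases he with ⟨rfl, rfl, he⟩ | ⟨rfl, rfl, he⟩ <;>
    rcases he' with ⟨rfl, rfl, he'⟩ | ⟨rfl, rfl, he'⟩ <;>
    rw [he, he', threadVertex_interior (by omega) (by omega),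
      threadVertex_interior (by omega) (by omega)] at heq <;>
    simp only [Sum.inr.injEq, Prod.mk.injEq, Fin.mk.injEq] at heq <;>
    obtain ⟨rfl, hi⟩ := heq
  · exact Or.inl ⟨rfl, rfl, by omega⟩
  · exact Or.inr ⟨rfl, rfl, by omega⟩
  · exact Or.inr ⟨rfl, rfl, by omega⟩
  · exact Or.inl ⟨rfl, rfl, by omega⟩

/-- From an interior point of a thread the robber can only move along the thread. -/
theorem eq_pt_of_adj_pt (hm : 1 ≤ m) {s z : V} (h : G.Adj s z) {f : ℕ} (h0 : 0 < f) (h1 : f < m)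
    {y : SubdivVertex G m} (hy : (subdivision G m).Adj (pt G m s z f) y) :
    ∃ f', f' ≤ m ∧ f ≤ f' + 1 ∧ f' ≤ f + 1 ∧ y = pt G m s z f' := by
  obtain ⟨s', z', g, h', hg, hx, rfl⟩ := exists_of_subdivision_adj hy
  rcases pt_inj hm h h' h0 h1 hg.le hx with ⟨rfl, rfl, rfl⟩ | ⟨rfl, rfl, rfl⟩
  · exact ⟨g + 1, hg, by omega, by omega, rfl⟩
  · refine ⟨f - 1, by omega, by omega, by omega, ?_⟩
    rw [pt_comm h' (by omega)]
    congr 1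
    omega

theorem eq_pt_of_adj_inl (hm : 1 ≤ m) {s : V} {y : SubdivVertex G m}
    (hy : (subdivision G m).Adj (Sum.inl s) y) : ∃ z, G.Adj s z ∧ y = pt G m s z 1 := by
  obtain ⟨s', z, f, h, hf, hx, rfl⟩ := exists_of_subdivision_adj hy
  rcases (pt_eq_inl_iff hm h hf.le).1 hx.symm with ⟨rfl, rfl⟩ | ⟨rfl, rfl⟩
  · exact ⟨z, h, rfl⟩
  · omega

end Points

section Distances

variable {V : Type u} {G : SimpleGraph V} {m : ℕ}

theorem exists_walk_pt (hm : 1 ≤ m) {s z : V} (h : G.Adj s z) {f n : ℕ} (hf : f + n ≤ m) :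
    ∃ p : (subdivision G m).Walk (pt G m s z f) (pt G m s z (f + n)), p.length = n := by
  induction n with
  | zero => exact ⟨SimpleGraph.Walk.nil, rfl⟩
  | succ n ih =>
    obtain ⟨p, hp⟩ := ih (by omega)
    exact ⟨p.concat (subdivision_adj_pt hm h (by omega)), by simp [hp]⟩

theorem exists_walk_inl (hm : 1 ≤ m) {s z : V} (p : G.Walk s z) :
    ∃ q : (subdivision G m).Walk (Sum.inl s) (Sum.inl z), q.length = m * p.length := by
  induction p with
  | nil => exact ⟨SimpleGraph.Walk.nil, rfl⟩
  | @cons s y z h p ih =>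
    obtain ⟨q, hq⟩ := ih
    obtain ⟨r, hr⟩ := exists_walk_pt hm h (show 0 + m ≤ m by omega)
    refine ⟨(r.copy (pt_zero hm _ _) (by rw [Nat.zero_add, pt_self hm h])).append q, ?_⟩
    simp [hq, hr, Nat.mul_add, Nat.add_comm]

theorem subdivision_connected (hm : 1 ≤ m) (hG : G.Connected) :
    (subdivision G m).Connected := by
  have hinl : ∀ s z : V, (subdivision G m).Reachable (Sum.inl s) (Sum.inl z) := fun s z =>
    let ⟨p⟩ := hG.preconnected s z
    let ⟨q, _⟩ := exists_walk_inl hm p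
    ⟨q⟩
  have hto : ∀ x : SubdivVertex G m, ∃ s : V, (subdivision G m).Reachable (Sum.inl s) x := by
    intro x
    rcases exists_eq_pt hm x with ⟨v, rfl⟩ | ⟨s, z, f, h, -, hf, rfl⟩
    · exact ⟨v, SimpleGraph.Reachable.refl _⟩
    · obtain ⟨q, -⟩ := exists_walk_pt hm h (show 0 + f ≤ m by omega)
      rw [pt_zero hm, Nat.zero_add] at q
      exact ⟨s, ⟨q⟩⟩
  have := hG.nonempty
  refine ⟨fun x y => ?_⟩
  obtain ⟨s, hs⟩ := hto x
  obtain ⟨z, hz⟩ := hto y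
  exact hs.symm.trans ((hinl s z).trans hz)

theorem dist_pt_pt_le (hm : 1 ≤ m) {s z : V} (h : G.Adj s z) {f f' : ℕ} (hff : f ≤ f')
    (hf' : f' ≤ m) : (subdivision G m).dist (pt G m s z f) (pt G m s z f') ≤ f' - f := by
  obtain ⟨n, rfl⟩ := Nat.exists_eq_add_of_le hff
  obtain ⟨p, hp⟩ := exists_walk_pt hm h hf'
  exact (SimpleGraph.dist_le p).trans (by omega)

theorem dist_inl_inl_le (hm : 1 ≤ m) (hG : G.Connected) (s z : V) :
    (subdivision G m).dist (Sum.inl s) (Sum.inl z) ≤ m * G.dist s z := by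
  obtain ⟨p, hp⟩ := hG.exists_walk_length_eq_dist s z
  obtain ⟨q, hq⟩ := exists_walk_inl hm p
  exact (SimpleGraph.dist_le q).trans (by rw [hq, hp])

open Classical in
/-- The function on the vertices of a subdivision with value `h v` at the branch vertex `v` and
`g e i` at the `i`-th vertex of the thread `e`. -/
noncomputable def glue (h : V → ℕ) (g : G.edgeSet → ℕ → ℕ) : SubdivVertex G m → ℕ
  | Sum.inl v => h v
  | Sum.inr (e, i) => g e (i + 1)

theorem glue_threadVertex (hm : 1 ≤ m) {h : V → ℕ} {g : G.edgeSet → ℕ → ℕ}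
    (h0 : ∀ e, g e 0 = h (Quot.out (e : Sym2 V)).1)
    (h1 : ∀ e, g e m = h (Quot.out (e : Sym2 V)).2) (e : G.edgeSet) {i : ℕ} (hi : i ≤ m) :
    glue h g (threadVertex G m e i) = g e i := by
  rcases Nat.eq_zero_or_pos i with rfl | hpos
  · rw [threadVertex_zero, h0]
    rfl
  rcases Nat.lt_or_ge i m with hlt | hge
  · rw [threadVertex_interior hpos hlt]
    exact congrArg (g e) (show i - 1 + 1 = i by omega)
  · obtain rfl : i = m := by omega
    rw [threadVertex_self hm, h1]
    rfl

/-- A lower bound on distances: a function that changes by at most one along each edge, and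
vanishes at `x`, is at most the distance from `x`. -/
theorem le_dist_of_lipschitz {W : Type*} {H : SimpleGraph W} (hH : H.Connected) {φ : W → ℕ}
    (hφ : ∀ x y, H.Adj x y → φ y ≤ φ x + 1) {x : W} (hx : φ x = 0) (y : W) :
    φ y ≤ H.dist x y := by
  obtain ⟨p, hp⟩ := hH.exists_walk_length_eq_dist x y
  rw [← hp]
  have key : ∀ {a b : W} (q : H.Walk a b), φ b ≤ φ a + q.length := by
    intro a b q
    induction q with
    | nil => simp
    | cons h q ih =>
      have := hφ _ _ h
      rw [SimpleGraph.Walk.length_cons]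
      omega
  simpa [hx] using key p

theorem le_dist_threadVertex (hm : 1 ≤ m) (hG : G.Connected) {h : V → ℕ}
    {g : G.edgeSet → ℕ → ℕ} (h0 : ∀ e, g e 0 = h (Quot.out (e : Sym2 V)).1)
    (h1 : ∀ e, g e m = h (Quot.out (e : Sym2 V)).2)
    (hg : ∀ e, ∀ i < m, g e (i + 1) ≤ g e i + 1 ∧ g e i ≤ g e (i + 1) + 1)
    {x : SubdivVertex G m} (hx : glue h g x = 0) (e : G.edgeSet) {i : ℕ} (hi : i ≤ m) :
    g e i ≤ (subdivision G m).dist x (threadVertex G m e i) := by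
  rw [← glue_threadVertex hm h0 h1 e hi]
  refine le_dist_of_lipschitz (subdivision_connected hm hG) (fun y y' hy => ?_) hx _
  rcases ((SimpleGraph.fromRel_adj _ _ _).1 hy).2 with ⟨e, i, hi, rfl, rfl⟩ | ⟨e, i, hi, rfl, rfl⟩
  · rw [glue_threadVertex hm h0 h1 e hi.le, glue_threadVertex hm h0 h1 e hi]
    exact (hg e i hi).1
  · rw [glue_threadVertex hm h0 h1 e hi.le, glue_threadVertex hm h0 h1 e hi]
    exact (hg e i hi).2

theorem dist_le_dist_add_one (hG : G.Connected) {s z : V} (h : G.Adj s z) (v : V) :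
    G.dist v s ≤ G.dist v z + 1 := by
  have h1 := hG.dist_triangle (u := v) (v := z) (w := s)
  rw [SimpleGraph.dist_eq_one_iff_adj.2 h.symm] at h1
  exact h1

theorem mul_dist_le (hG : G.Connected) {s z : V} (h : G.Adj s z) (v : V) :
    m * G.dist v s ≤ m * G.dist v z + m := by
  have := Nat.mul_le_mul_left m (dist_le_dist_add_one hG h v)
  rwa [Nat.mul_add, Nat.mul_one] at this

theorem dist_inl_pt (hm : 1 ≤ m) (hG : G.Connected) (v : V) {s z : V} (h : G.Adj s z) {f : ℕ}
    (hf : f ≤ m) :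
    (subdivision G m).dist (Sum.inl v) (pt G m s z f) =
      min (m * G.dist v s + f) (m * G.dist v z + (m - f)) := by
  have htri := fun x y z => (subdivision_connected hm hG).dist_triangle (u := x) (v := y) (w := z)
  apply le_antisymm
  · apply le_min
    · refine (htri _ (Sum.inl s) _).trans (add_le_add (dist_inl_inl_le hm hG v s) ?_)
      have := dist_pt_pt_le hm h (Nat.zero_le f) hf
      rwa [pt_zero hm] at this
    · refine (htri _ (Sum.inl z) _).trans (add_le_add (dist_inl_inl_le hm hG v z) ?_)
      have := dist_pt_pt_le hm h hf le_rfl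
      rwa [pt_self hm h, SimpleGraph.dist_comm] at this
  · have key : ∀ (e : G.edgeSet) {i : ℕ}, i ≤ m →
        min (m * G.dist v (Quot.out (e : Sym2 V)).1 + i)
          (m * G.dist v (Quot.out (e : Sym2 V)).2 + (m - i)) ≤
        (subdivision G m).dist (Sum.inl v) (threadVertex G m e i) := by
      intro e i hi
      refine le_dist_threadVertex hm hG (h := fun u => m * G.dist v u)
        (g := fun e i => min (m * G.dist v (Quot.out (e : Sym2 V)).1 + i)
          (m * G.dist v (Quot.out (e : Sym2 V)).2 + (m - i)))
        (fun e => ?_) (fun e => ?_) (fun e i hi => ?_) ?_ e hi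
      · have := mul_dist_le (m := m) hG (adj_out e) v
        omega
      · have := mul_dist_le (m := m) hG (adj_out e).symm v
        omega
      · omega
      · simp [glue]
    obtain ⟨e, ⟨rfl, rfl, he⟩ | ⟨rfl, rfl, he⟩⟩ := exists_threadVertex (m := m) h
    · rw [he]
      exact key e hf
    · rw [he, min_comm]
      have := key e (Nat.sub_le m f)
      rwa [Nat.sub_sub_self hf] at this

open Classical in
theorem le_dist_threadVertex_threadVertex (hm : 1 ≤ m) (hG : G.Connected) (e₀ : G.edgeSet) {j : ℕ}
    (hj : j ≤ m) (e : G.edgeSet) {i : ℕ} (hi : i ≤ m) :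
    (if e = e₀ then (j - i) + (i - j) else
      min (min (j + m * G.dist (Quot.out (e₀ : Sym2 V)).1 (Quot.out (e : Sym2 V)).1 + i)
          (j + m * G.dist (Quot.out (e₀ : Sym2 V)).1 (Quot.out (e : Sym2 V)).2 + (m - i)))
        (min (m - j + m * G.dist (Quot.out (e₀ : Sym2 V)).2 (Quot.out (e : Sym2 V)).1 + i)
          (m - j + m * G.dist (Quot.out (e₀ : Sym2 V)).2 (Quot.out (e : Sym2 V)).2 + (m - i)))) ≤
      (subdivision G m).dist (threadVertex G m e₀ j) (threadVertex G m e i) := by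
  set a := (Quot.out (e₀ : Sym2 V)).1 with ha
  set b := (Quot.out (e₀ : Sym2 V)).2 with hb
  have hab : G.dist a b = 1 := SimpleGraph.dist_eq_one_iff_adj.2 (adj_out e₀)
  have hba : G.dist b a = 1 := SimpleGraph.dist_eq_one_iff_adj.2 (adj_out e₀).symm
  let h : V → ℕ := fun u => min (j + m * G.dist a u) (m - j + m * G.dist b u)
  let g : G.edgeSet → ℕ → ℕ := fun e i => if e = e₀ then (j - i) + (i - j) else
      min (min (j + m * G.dist a (Quot.out (e : Sym2 V)).1 + i)
          (j + m * G.dist a (Quot.out (e : Sym2 V)).2 + (m - i)))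
        (min (m - j + m * G.dist b (Quot.out (e : Sym2 V)).1 + i)
          (m - j + m * G.dist b (Quot.out (e : Sym2 V)).2 + (m - i)))
  have h0 : ∀ e : G.edgeSet, g e 0 = h (Quot.out (e : Sym2 V)).1 := by
    intro e
    simp only [g, h]
    split_ifs with he
    · subst he
      rw [← ha, hba, SimpleGraph.dist_self, Nat.mul_zero, Nat.mul_one]
      omega
    · have h1 := mul_dist_le (m := m) hG (adj_out e) a
      have h2 := mul_dist_le (m := m) hG (adj_out e) b
      omega
  have h1 : ∀ e : G.edgeSet, g e m = h (Quot.out (e : Sym2 V)).2 := by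
    intro e
    simp only [g, h]
    split_ifs with he
    · subst he
      rw [← hb, hab, SimpleGraph.dist_self, Nat.mul_zero, Nat.mul_one]
      omega
    · have h1 := mul_dist_le (m := m) hG (adj_out e).symm a
      have h2 := mul_dist_le (m := m) hG (adj_out e).symm b
      omega
  refine le_dist_threadVertex hm hG h0 h1 (fun e i hi => ?_) ?_ e hi
  · simp only [g]
    split_ifs <;> omega
  · rw [glue_threadVertex hm h0 h1 e₀ hj]
    simp [g]

theorem dist_pt_pt_same (hm : 1 ≤ m) (hG : G.Connected) {a b : V} (h : G.Adj a b) {j f : ℕ}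
    (hj : j ≤ m) (hf : f ≤ m) :
    (subdivision G m).dist (pt G m a b j) (pt G m a b f) = (j - f) + (f - j) := by
  apply le_antisymm
  · rcases le_total j f with hjf | hjf
    · exact (dist_pt_pt_le hm h hjf hf).trans (by omega)
    · rw [SimpleGraph.dist_comm]
      exact (dist_pt_pt_le hm h hjf hj).trans (by omega)
  · obtain ⟨e, ⟨rfl, rfl, he⟩ | ⟨rfl, rfl, he⟩⟩ := exists_threadVertex (m := m) h
    · have := le_dist_threadVertex_threadVertex hm hG e hj e hf
      rwa [if_pos rfl, ← he, ← he] at this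
    · have := le_dist_threadVertex_threadVertex hm hG e (Nat.sub_le m j) e (Nat.sub_le m f)
      rw [if_pos rfl, ← he, ← he] at this
      omega

theorem dist_pt_pt (hm : 1 ≤ m) (hG : G.Connected) {a b s z : V} (h : G.Adj a b) (h' : G.Adj s z)
    (hne : s(s, z) ≠ s(a, b)) {j f : ℕ} (hj : j ≤ m) (hf : f ≤ m) :
    (subdivision G m).dist (pt G m a b j) (pt G m s z f) =
      min (min (j + m * G.dist a s + f) (j + m * G.dist a z + (m - f)))
        (min (m - j + m * G.dist b s + f) (m - j + m * G.dist b z + (m - f))) := by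
  apply le_antisymm
  · have htri :=
      fun x y z => (subdivision_connected hm hG).dist_triangle (u := x) (v := y) (w := z)
    have ha := htri (pt G m a b j) (Sum.inl a) (pt G m s z f)
    have hb := htri (pt G m a b j) (Sum.inl b) (pt G m s z f)
    rw [dist_inl_pt hm hG _ h' hf] at ha hb
    have ha' := dist_pt_pt_le hm h (Nat.zero_le j) hj
    rw [pt_zero hm, SimpleGraph.dist_comm] at ha'
    have hb' := dist_pt_pt_le hm h hj le_rfl
    rw [pt_self hm h] at hb'
    omega
  · obtain ⟨e₀, he₀⟩ := exists_threadVertex (m := m) h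
    obtain ⟨e, he⟩ := exists_threadVertex (m := m) h'
    have hee : e ≠ e₀ := by
      rintro rfl
      apply hne
      rcases he with ⟨rfl, rfl, -⟩ | ⟨rfl, rfl, -⟩ <;>
        rcases he₀ with ⟨rfl, rfl, -⟩ | ⟨rfl, rfl, -⟩ <;>
          first | rfl | exact Sym2.eq_swap
    rcases he₀ with ⟨rfl, rfl, he₀⟩ | ⟨rfl, rfl, he₀⟩ <;>
      rcases he with ⟨rfl, rfl, he⟩ | ⟨rfl, rfl, he⟩
    · have := le_dist_threadVertex_threadVertex hm hG e₀ hj e hf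
      rw [if_neg hee, ← he, ← he₀] at this
      omega
    · have := le_dist_threadVertex_threadVertex hm hG e₀ hj e (Nat.sub_le m f)
      rw [if_neg hee, ← he, ← he₀] at this
      omega
    · have := le_dist_threadVertex_threadVertex hm hG e₀ (Nat.sub_le m j) e hf
      rw [if_neg hee, ← he, ← he₀] at this
      omega
    · have := le_dist_threadVertex_threadVertex hm hG e₀ (Nat.sub_le m j) e (Nat.sub_le m f)
      rw [if_neg hee, ← he, ← he₀] at this
      omega

end Distances

/-! ### What the probes tell -/

section Facts

variable {V : Type u} {G : SimpleGraph V} {m : ℕ}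

theorem le_mul_dist (hG : G.Connected) {u v : V} (h : u ≠ v) : m ≤ m * G.dist u v :=
  Nat.le_mul_of_pos_right m (hG.pos_dist_of_ne h)

theorem mul_add_mod_cases {m t w r : ℕ} (hr : (m * t + w) % m = r) (hw : w ≤ 2 * m) (hm : 1 ≤ m) :
    (r = w ∨ r + m = w ∨ r + 2 * m = w) ∧ r < m := by
  rw [Nat.mul_add_mod] at hr
  have hlt := Nat.mod_lt w hm
  have hdiv := Nat.mod_add_div w m
  have hq : w / m ≤ 2 := Nat.div_le_of_le_mul (by omega)
  rw [hr] at hlt hdiv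
  refine ⟨?_, hlt⟩
  generalize w / m = q at hq hdiv
  interval_cases q <;> omega

theorem dist_inl_pt_left (hm : 1 ≤ m) (hG : G.Connected) {s z : V} (h : G.Adj s z) {f : ℕ}
    (hf : f ≤ m) : (subdivision G m).dist (Sum.inl s) (pt G m s z f) = f := by
  rw [dist_inl_pt hm hG s h hf, SimpleGraph.dist_self, SimpleGraph.dist_eq_one_iff_adj.2 h]
  omega

theorem dist_inl_pt_right (hm : 1 ≤ m) (hG : G.Connected) {s z : V} (h : G.Adj s z) {f : ℕ}
    (hf : f ≤ m) : (subdivision G m).dist (Sum.inl z) (pt G m s z f) = m - f := by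
  rw [pt_comm h hf, dist_inl_pt_left hm hG h.symm (Nat.sub_le m f)]

theorem le_dist_inl_pt (hm : 1 ≤ m) (hG : G.Connected) {v s z : V} (h : G.Adj s z) {f : ℕ}
    (hf : f ≤ m) (hs : v ≠ s) (hz : v ≠ z) :
    m + min f (m - f) ≤ (subdivision G m).dist (Sum.inl v) (pt G m s z f) := by
  rw [dist_inl_pt hm hG v h hf]
  have h1 := le_mul_dist (m := m) hG hs
  have h2 := le_mul_dist (m := m) hG hz
  omega

/-- Modulo `m`, a probe at a branch vertex tells the position of the robber on his thread, up to
its orientation. -/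
theorem dist_inl_pt_mod (hm : 1 ≤ m) (hG : G.Connected) {v s z : V} (h : G.Adj s z) {f d : ℕ}
    (hf : f ≤ m) (hd : (subdivision G m).dist (Sum.inl v) (pt G m s z f) = d) :
    (d % m = f ∨ d % m + f = m) ∧ d % m < m := by
  rw [dist_inl_pt hm hG v h hf] at hd
  rcases min_choice (m * G.dist v s + f) (m * G.dist v z + (m - f)) with h1 | h1 <;>
    rw [h1] at hd <;> subst hd
  · have := mul_add_mod_cases (m := m) (t := G.dist v s) (w := f) rfl (by omega) hm
    omega
  · have := mul_add_mod_cases (m := m) (t := G.dist v z) (w := m - f) rfl (by omega) hm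
    omega

theorem edge_ne_of_left {a b s z : V} (hs : s ≠ a) (hs' : s ≠ b) : s(s, z) ≠ s(a, b) := by
  intro h
  rcases Sym2.eq_iff.1 h with h | h
  · exact hs h.1
  · exact hs' h.1

/-- A probe inside the thread `ab`, not beyond its middle: the robber on a thread that ends
in `a`. -/
theorem dist_pt_pt_fst (hm : 1 ≤ m) (hG : G.Connected) {a b s : V} (h : G.Adj a b)
    (hs : G.Adj s a) (hsb : s ≠ b) {j f : ℕ} (hj : 2 * j ≤ m) (hf : f ≤ m) :
    (subdivision G m).dist (pt G m a b j) (pt G m s a f) = j + (m - f) := by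
  rw [dist_pt_pt hm hG h hs (edge_ne_of_left hs.ne hsb) (by omega) hf, SimpleGraph.dist_self]
  have h1 := le_mul_dist (m := m) hG hs.ne.symm
  have h2 := le_mul_dist (m := m) hG hsb.symm
  have h3 := le_mul_dist (m := m) hG h.ne.symm
  omega

/-- A probe inside the thread `ab`, not beyond its middle: the robber on a thread that ends
in `b`. -/
theorem dist_pt_pt_snd (hm : 1 ≤ m) (hG : G.Connected) {a b s : V} (h : G.Adj a b)
    (hs : G.Adj s b) (hsa : s ≠ a) {j f : ℕ} (hj : 2 * j ≤ m) (hf : f ≤ m) :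
    (subdivision G m).dist (pt G m a b j) (pt G m s b f) ≤ (m - j) + (m - f) ∧
      ((subdivision G m).dist (pt G m a b j) (pt G m s b f) = (m - j) + (m - f) ∨
        m + j + f ≤ (subdivision G m).dist (pt G m a b j) (pt G m s b f)) := by
  rw [dist_pt_pt hm hG h hs (edge_ne_of_left hsa hs.ne) (by omega) hf, SimpleGraph.dist_self]
  have h1 := le_mul_dist (m := m) hG hs.ne.symm
  have h2 := le_mul_dist (m := m) hG hsa.symm
  have h3 := le_mul_dist (m := m) hG h.ne
  omega

theorem dist_pt_pt_snd_of_adj (hm : 1 ≤ m) (hG : G.Connected) {a b s : V} (h : G.Adj a b)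
    (hs : G.Adj s b) (hsa : G.Adj s a) {j f : ℕ} (hj : 2 * j ≤ m) (hf : f ≤ m) :
    (subdivision G m).dist (pt G m a b j) (pt G m s b f) =
      min ((m - j) + (m - f)) (m + j + f) := by
  rw [dist_pt_pt hm hG h hs (edge_ne_of_left hsa.ne hs.ne) (by omega) hf, SimpleGraph.dist_self,
    SimpleGraph.dist_eq_one_iff_adj.2 h, SimpleGraph.dist_eq_one_iff_adj.2 hs.symm,
    SimpleGraph.dist_eq_one_iff_adj.2 hsa.symm]
  omega

/-- A probe inside the thread `ab`, not beyond its middle: the robber on a thread with neither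
end in `a` or `b`. -/
theorem le_dist_pt_pt (hm : 1 ≤ m) (hG : G.Connected) {a b s z : V} (h : G.Adj a b)
    (hs : G.Adj s z) (hsa : s ≠ a) (hsb : s ≠ b) (hza : z ≠ a) (hzb : z ≠ b) {j f : ℕ}
    (hj : 2 * j ≤ m) (hf : f ≤ m) :
    m + j + min f (m - f) ≤ (subdivision G m).dist (pt G m a b j) (pt G m s z f) := by
  rw [dist_pt_pt hm hG h hs (edge_ne_of_left hsa hsb) (by omega) hf]
  have h1 := le_mul_dist (m := m) hG hsa.symm
  have h2 := le_mul_dist (m := m) hG hsb.symm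
  have h3 := le_mul_dist (m := m) hG hza.symm
  have h4 := le_mul_dist (m := m) hG hzb.symm
  omega

theorem dist_pt_pt_of_adj (hm : 1 ≤ m) (hG : G.Connected) {a b s z : V} (h : G.Adj a b)
    (hs : G.Adj s z) (hsa : G.Adj s a) (hsb : s ≠ b) (hza : z ≠ a) (hzb : z ≠ b) {j f : ℕ}
    (hj : 2 * j ≤ m) (hf : 2 * f ≤ m) :
    (subdivision G m).dist (pt G m a b j) (pt G m s z f) = m + j + f := by
  have h0 := le_dist_pt_pt hm hG h hs hsa.ne hsb hza hzb hj (show f ≤ m by omega)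
  rw [dist_pt_pt hm hG h hs (edge_ne_of_left hsa.ne hsb) (by omega) (by omega),
    SimpleGraph.dist_eq_one_iff_adj.2 hsa.symm] at h0 ⊢
  omega

/-- What a probe inside the thread `ab` tells modulo `m`: the shortest path passes one of the two
ends of either thread. -/
theorem dist_pt_pt_mod (hm : 1 ≤ m) (hG : G.Connected) {a b s z : V} (h : G.Adj a b)
    (hs : G.Adj s z) (hsa : s ≠ a) (hsb : s ≠ b) {j f d : ℕ}
    (hj : 2 * j ≤ m) (hf : f ≤ m)
    (hd : (subdivision G m).dist (pt G m a b j) (pt G m s z f) = d) :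
    ∃ w, (w = j + f ∨ w = j + (m - f) ∨ w = (m - j) + f ∨ w = (m - j) + (m - f)) ∧
      (d % m = w ∨ d % m + m = w ∨ d % m + 2 * m = w) ∧ d % m < m := by
  rw [dist_pt_pt hm hG h hs (edge_ne_of_left hsa hsb) (by omega) hf] at hd
  have key : ∀ t w, d = m * t + w → w ≤ 2 * m →
      (d % m = w ∨ d % m + m = w ∨ d % m + 2 * m = w) ∧ d % m < m := by
    rintro t w rfl hw
    exact mul_add_mod_cases rfl hw hm
  have h4 : d = m * G.dist a s + (j + f) ∨ d = m * G.dist a z + (j + (m - f)) ∨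
      d = m * G.dist b s + ((m - j) + f) ∨ d = m * G.dist b z + ((m - j) + (m - f)) := by
    omega
  rcases h4 with h4 | h4 | h4 | h4
  · exact ⟨_, Or.inl rfl, key _ _ h4 (by omega)⟩
  · exact ⟨_, Or.inr (Or.inl rfl), key _ _ h4 (by omega)⟩
  · exact ⟨_, Or.inr (Or.inr (Or.inl rfl)), key _ _ h4 (by omega)⟩
  · exact ⟨_, Or.inr (Or.inr (Or.inr rfl)), key _ _ h4 (by omega)⟩

end Facts

/-! ### Sets of candidate locations in a subdivision -/

section States

variable {V : Type u} {G : SimpleGraph V} {m : ℕ}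

/-- The branch vertices belonging to `S`. -/
def branch (G : SimpleGraph V) (m : ℕ) (S : Set V) : Set (SubdivVertex G m) := Sum.inl '' S

/-- The points `pt G m s z f` with `P s z f`. -/
def loc (G : SimpleGraph V) (m : ℕ) (P : V → V → ℕ → Prop) : Set (SubdivVertex G m) :=
  {x | ∃ s z f, G.Adj s z ∧ f ≤ m ∧ P s z f ∧ x = pt G m s z f}

theorem loc_subset {P : V → V → ℕ → Prop} {T : Set (SubdivVertex G m)}
    (h : ∀ s z f, G.Adj s z → f ≤ m → P s z f → pt G m s z f ∈ T) : loc G m P ⊆ T := by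
  rintro _ ⟨s, z, f, hs, hf, hP, rfl⟩
  exact h s z f hs hf hP

theorem mem_loc {P : V → V → ℕ → Prop} {s z : V} {f : ℕ} (h : G.Adj s z) (hf : f ≤ m)
    (hP : P s z f) : pt G m s z f ∈ loc G m P :=
  ⟨s, z, f, h, hf, hP, rfl⟩

theorem pt_mem_branch (hm : 1 ≤ m) {S : Set V} {s z : V} {f : ℕ} (h : G.Adj s z)
    (hf : (f = 0 ∧ s ∈ S) ∨ (f = m ∧ z ∈ S)) : pt G m s z f ∈ branch G m S := by
  rcases hf with ⟨rfl, hs⟩ | ⟨rfl, hz⟩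
  · rw [pt_zero hm]
    exact ⟨s, hs, rfl⟩
  · rw [pt_self hm h]
    exact ⟨z, hz, rfl⟩

theorem branch_mono {S T : Set V} (h : S ⊆ T) : branch G m S ⊆ branch G m T :=
  Set.image_mono h

/-- Candidates that are all interior points of threads, after one more move and one more probe. -/
theorem CopWins.probe_loc [Finite V] (hm : 1 ≤ m) {P : V → V → ℕ → Prop}
    (hP : ∀ s z f, G.Adj s z → P s z f → 0 < f ∧ f < m) (p : SubdivVertex G m)
    (h : ∀ d, CopWins (subdivision G m) (loc G m fun s z f' =>
      (∃ f, P s z f ∧ f ≤ f' + 1 ∧ f' ≤ f + 1) ∧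
        (subdivision G m).dist p (pt G m s z f') = d)) :
    CopWins (subdivision G m) (loc G m P) := by
  refine CopWins.probe p fun d => (h d).mono ?_
  rintro y ⟨⟨x, ⟨s, z, f, hs, hf, hPf, rfl⟩, hxy⟩, hd⟩
  obtain ⟨h0, h1⟩ := hP s z f hs hPf
  rcases hxy with rfl | hxy
  · exact ⟨s, z, f, hs, hf, ⟨⟨f, hPf, by omega, by omega⟩, hd⟩, rfl⟩
  · obtain ⟨f', hf', h2, h3, rfl⟩ := eq_pt_of_adj_pt hm hs h0 h1 hxy
    exact ⟨s, z, f', hs, hf', ⟨⟨f, hPf, h2, h3⟩, hd⟩, rfl⟩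

/-- Candidates that are all branch vertices, after one more move and one more probe. -/
theorem CopWins.probe_branch [Finite V] (hm : 1 ≤ m) {S : Set V} (p : SubdivVertex G m)
    (h : ∀ d, CopWins (subdivision G m)
      (branch G m {s | s ∈ S ∧ (subdivision G m).dist p (Sum.inl s) = d} ∪
        loc G m fun s z f =>
          (s ∈ S ∧ f = 1) ∧ (subdivision G m).dist p (pt G m s z f) = d)) :
    CopWins (subdivision G m) (branch G m S) := by
  refine CopWins.probe p fun d => (h d).mono ?_
  rintro y ⟨⟨x, ⟨s, hs, rfl⟩, hxy⟩, hd⟩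
  rcases hxy with rfl | hxy
  · exact Or.inl ⟨s, ⟨hs, hd⟩, rfl⟩
  · obtain ⟨z, hz, rfl⟩ := eq_pt_of_adj_inl hm hxy
    exact Or.inr ⟨s, z, 1, hz, hm, ⟨⟨hs, rfl⟩, hd⟩, rfl⟩

theorem CopWins.branch_of_subsingleton {S : Set V} (h : S.Subsingleton) :
    CopWins (subdivision G m) (branch G m S) :=
  CopWins.of_subsingleton (h.image _)

end States

/-! ### Winning once an end of the robber's thread is known -/

section KnownEnd

variable {V : Type u} [Finite V] {G : SimpleGraph V} {m : ℕ}

/-- The robber is inside a thread from `a` to a vertex of `Y`. Probes at `a` give his exact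
position, so that the vertices of `Y` can be ruled out one at a time, until he comes to a branch
vertex. -/
theorem copWins_knownEnd (hm : 3 ≤ m) (hG : G.Connected) (a : V) {Y : Set V}
    (hY : CopWins (subdivision G m) (branch G m Y)) :
    CopWins (subdivision G m) (loc G m fun s z f => s = a ∧ z ∈ Y ∧ 0 < f ∧ f < m) := by
  have hm1 : 1 ≤ m := by omega
  induction Y, Y.toFinite using Set.Finite.induction_on with
  | empty =>
    refine CopWins.of_subsingleton (Set.subsingleton_empty.anti (loc_subset ?_))
    rintro s z f - - ⟨-, hz, -⟩
    exact hz
  | @insert y Y hyY hfin ih =>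
    have ih := ih (hY.mono (branch_mono (Set.subset_insert y Y)))
    by_cases hay : a = y
    · refine ih.mono (loc_subset ?_)
      rintro s z f hs hf ⟨rfl, hz, h0⟩
      exact mem_loc hs hf ⟨rfl, Set.mem_of_mem_insert_of_ne hz (hay ▸ hs.ne.symm), h0⟩
    have exact_pos : ∀ p, 0 < p → p < m → CopWins (subdivision G m)
        (loc G m fun s z f => s = a ∧ z ∈ insert y Y ∧ f = p) := by
      intro p hp0 hpm
      refine CopWins.probe_loc hm1 (by rintro s z f - ⟨-, -, rfl⟩; exact ⟨hp0, hpm⟩)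
        (Sum.inl y) fun d => ?_
      by_cases hd : d < m
      · refine CopWins.of_subsingleton
          (Set.subsingleton_singleton (a := pt G m a y (m - d)) |>.anti (loc_subset ?_))
        rintro s z f hs hf ⟨⟨g, ⟨rfl, hz, hg⟩, h1, h2⟩, hD⟩
        by_cases hzy : z = y
        · subst hzy
          rw [dist_inl_pt_right hm1 hG hs hf] at hD
          rw [show f = m - d by omega]
          rfl
        · have := le_dist_inl_pt hm1 hG hs hf (Ne.symm hay) (Ne.symm hzy)
          omega
      by_cases hr : d % m = 0
      · by_cases hp1 : p = 1
        · refine CopWins.mono (CopWins.branch_of_subsingleton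
            (Set.subsingleton_singleton (a := a))) (loc_subset ?_)
          rintro s z f hs hf ⟨⟨g, ⟨rfl, hz, hg⟩, h1, h2⟩, hD⟩
          have := dist_inl_pt_mod hm1 hG hs hf hD
          exact pt_mem_branch hm1 hs (Or.inl ⟨by omega, rfl⟩)
        · refine hY.mono (loc_subset ?_)
          rintro s z f hs hf ⟨⟨g, ⟨rfl, hz, hg⟩, h1, h2⟩, hD⟩
          have := dist_inl_pt_mod hm1 hG hs hf hD
          exact pt_mem_branch hm1 hs (Or.inr ⟨by omega, hz⟩)
      · refine ih.mono (loc_subset ?_)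
        rintro s z f hs hf ⟨⟨g, ⟨rfl, hz, hg⟩, h1, h2⟩, hD⟩
        have hmod := dist_inl_pt_mod hm1 hG hs hf hD
        have hzy : z ≠ y := by
          rintro rfl
          rw [dist_inl_pt_right hm1 hG hs hf] at hD
          omega
        refine mem_loc hs hf ⟨rfl, Set.mem_of_mem_insert_of_ne hz hzy, ?_⟩
        have h3 : f ≠ 0 := by
          rintro rfl
          rw [dist_inl_pt hm1 hG y hs hf] at hD
          omega
        omega
    refine CopWins.probe_loc hm1 (fun s z f _ h => h.2.2) (Sum.inl a) fun d => ?_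
    by_cases hd0 : d = 0
    · refine CopWins.mono (CopWins.branch_of_subsingleton
        (Set.subsingleton_singleton (a := a))) (loc_subset ?_)
      rintro s z f hs hf ⟨⟨g, ⟨rfl, hz, hg⟩, h1, h2⟩, hD⟩
      rw [dist_inl_pt_left hm1 hG hs hf] at hD
      exact pt_mem_branch hm1 hs (Or.inl ⟨by omega, rfl⟩)
    by_cases hdm : d < m
    · refine (exact_pos d (by omega) hdm).mono (loc_subset ?_)
      rintro s z f hs hf ⟨⟨g, ⟨rfl, hz, hg⟩, h1, h2⟩, hD⟩
      rw [dist_inl_pt_left hm1 hG hs hf] at hD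
      exact mem_loc hs hf ⟨rfl, hz, hD⟩
    · refine hY.mono (loc_subset ?_)
      rintro s z f hs hf ⟨⟨g, ⟨rfl, hz, hg⟩, h1, h2⟩, hD⟩
      rw [dist_inl_pt_left hm1 hG hs hf] at hD
      exact pt_mem_branch hm1 hs (Or.inr ⟨by omega, hz⟩)

/-- As `copWins_knownEnd`, with the positions measured from the other end. -/
theorem copWins_knownEnd' (hm : 3 ≤ m) (hG : G.Connected) (a : V) {Y : Set V}
    (hY : CopWins (subdivision G m) (branch G m Y)) :
    CopWins (subdivision G m) (loc G m fun s z f => s ∈ Y ∧ z = a ∧ 0 < f ∧ f < m) := by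
  refine (copWins_knownEnd hm hG a hY).mono (loc_subset ?_)
  rintro s z f hs hf ⟨hs', rfl, h0, h1⟩
  rw [pt_comm hs hf]
  exact mem_loc hs.symm (Nat.sub_le m f) ⟨rfl, hs', by omega, by omega⟩

/-- The robber is inside a thread both of whose ends are in `S`. -/
theorem copWins_ends (hm : 3 ≤ m) (hG : G.Connected) {S : Set V}
    (hS : CopWins (subdivision G m) (branch G m S)) :
    CopWins (subdivision G m) (loc G m fun s z f => s ∈ S ∧ z ∈ S ∧ 0 < f ∧ f < m) := by
  have hm1 : 1 ≤ m := by omega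
  suffices h : ∀ U ⊆ S, CopWins (subdivision G m)
      (loc G m fun s z f => s ∈ U ∧ z ∈ U ∧ 0 < f ∧ f < m) from h S subset_rfl
  intro U
  induction U, U.toFinite using Set.Finite.induction_on with
  | empty =>
    intro _
    refine CopWins.of_subsingleton (Set.subsingleton_empty.anti (loc_subset ?_))
    rintro s z f - - ⟨hz, -⟩
    exact hz
  | @insert v U hvU hfin ih =>
    intro hUS
    have ih := ih ((Set.subset_insert v U).trans hUS)
    refine CopWins.probe_loc hm1 (fun s z f _ h => h.2.2) (Sum.inl v) fun d => ?_
    by_cases hr : d % m = 0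
    · refine hS.mono (loc_subset ?_)
      rintro s z f hs hf ⟨⟨g, ⟨hsU, hzU, hg⟩, h1, h2⟩, hD⟩
      have := dist_inl_pt_mod hm1 hG hs hf hD
      rcases Nat.eq_zero_or_pos f with h0 | h0
      · exact pt_mem_branch hm1 hs (Or.inl ⟨h0, hUS hsU⟩)
      · exact pt_mem_branch hm1 hs (Or.inr ⟨by omega, hUS hzU⟩)
    by_cases hd : d < m
    · refine (copWins_knownEnd hm hG v hS).mono (loc_subset ?_)
      rintro s z f hs hf ⟨⟨g, ⟨hsU, hzU, hg⟩, h1, h2⟩, hD⟩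
      have := dist_inl_pt_mod hm1 hG hs hf hD
      by_cases hsv : v = s
      · exact mem_loc hs hf ⟨hsv.symm, hUS hzU, by omega, by omega⟩
      by_cases hzv : v = z
      · rw [pt_comm hs hf]
        exact mem_loc hs.symm (Nat.sub_le m f) ⟨hzv.symm, hUS hsU, by omega, by omega⟩
      have := le_dist_inl_pt hm1 hG hs hf hsv hzv
      omega
    · refine ih.mono (loc_subset ?_)
      rintro s z f hs hf ⟨⟨g, ⟨hsU, hzU, hg⟩, h1, h2⟩, hD⟩
      have := dist_inl_pt_mod hm1 hG hs hf hD
      have hsv : s ≠ v := by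
        rintro rfl
        rw [dist_inl_pt_left hm1 hG hs hf] at hD
        obtain rfl : d = m := by omega
        exact hr (Nat.mod_self d)
      have hzv : z ≠ v := by
        rintro rfl
        rw [dist_inl_pt_right hm1 hG hs hf] at hD
        obtain rfl : d = m := by omega
        exact hr (Nat.mod_self d)
      have hf0 : f ≠ 0 ∧ f ≠ m := by
        refine ⟨?_, ?_⟩ <;> rintro rfl <;> omega
      exact mem_loc hs hf ⟨Set.mem_of_mem_insert_of_ne hsU hsv,
        Set.mem_of_mem_insert_of_ne hzU hzv, by omega, by omega⟩

/-- If the cop wins when she knows that the robber is at a branch vertex, she wins. -/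
theorem copWins_univ (hm : 3 ≤ m) (hG : G.Connected)
    (h : CopWins (subdivision G m) (branch G m Set.univ)) :
    CopWins (subdivision G m) Set.univ := by
  have hm1 : 1 ≤ m := by omega
  obtain ⟨v⟩ := hG.nonempty
  refine CopWins.probe (Sum.inl v) fun d => ?_
  by_cases hr : d % m = 0
  · refine h.mono ?_
    rintro y ⟨-, hD⟩
    rcases exists_eq_pt hm1 y with ⟨s, rfl⟩ | ⟨s, z, f, hs, h0, h1, rfl⟩
    · exact ⟨s, trivial, rfl⟩
    · have := dist_inl_pt_mod hm1 hG hs h1.le hD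
      omega
  · refine (copWins_ends hm hG h).mono ?_
    rintro y ⟨-, hD⟩
    rcases exists_eq_pt hm1 y with ⟨s, rfl⟩ | ⟨s, z, f, hs, h0, h1, rfl⟩
    · exfalso
      by_cases hsv : v = s
      · subst hsv
        rw [SimpleGraph.dist_self] at hD
        subst hD
        exact hr (Nat.zero_mod m)
      · obtain ⟨p⟩ := hG.preconnected s v
        cases p with
        | nil => exact hsv rfl
        | cons hadj p =>
          rw [← pt_zero hm1 s] at hD
          have := dist_inl_pt_mod hm1 hG hadj (Nat.zero_le m) hD
          omega
    · exact mem_loc hs h1.le ⟨trivial, trivial, h0, h1⟩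

/-- The robber is on a thread from `S` to `a` or to `b`, in a known position in either case. A
probe at `a` tells which it is. -/
theorem copWins_twoEnds (hm : 3 ≤ m) (hG : G.Connected) {S : Set V}
    (hS : CopWins (subdivision G m) (branch G m S)) {a b : V} (hab : a ≠ b) (ha : a ∉ S)
    {f₁ f₂ : ℕ} (hf : ¬ (f₁ = 1 ∧ f₂ + 1 = m)) :
    CopWins (subdivision G m) (loc G m fun s z f =>
      s ∈ S ∧ 0 < f ∧ f < m ∧ ((z = a ∧ f = f₁) ∨ (z = b ∧ f = f₂))) := by
  have hm1 : 1 ≤ m := by omega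
  refine CopWins.probe_loc hm1 (fun s z f _ h => ⟨h.2.1, h.2.2.1⟩) (Sum.inl a) fun d => ?_
  by_cases hd0 : d = 0
  · refine CopWins.mono (CopWins.branch_of_subsingleton
      (Set.subsingleton_singleton (a := a))) (loc_subset ?_)
    rintro s z f hs hf' ⟨⟨g, ⟨hsS, hg0, hgm, hz⟩, h1, h2⟩, hD⟩
    have hsa : a ≠ s := fun h => ha (h ▸ hsS)
    by_cases hza : z = a
    · subst hza
      rw [dist_inl_pt_right hm1 hG hs hf'] at hD
      exact pt_mem_branch hm1 hs (Or.inr ⟨by omega, rfl⟩)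
    · have := le_dist_inl_pt hm1 hG hs hf' hsa (Ne.symm hza)
      omega
  by_cases hd : d < m
  · refine (copWins_knownEnd' hm hG a hS).mono (loc_subset ?_)
    rintro s z f hs hf' ⟨⟨g, ⟨hsS, hg0, hgm, hz⟩, h1, h2⟩, hD⟩
    have hsa : a ≠ s := fun h => ha (h ▸ hsS)
    by_cases hza : z = a
    · subst hza
      rw [dist_inl_pt_right hm1 hG hs hf'] at hD
      exact mem_loc hs hf' ⟨hsS, rfl, by omega, by omega⟩
    · have := le_dist_inl_pt hm1 hG hs hf' hsa (Ne.symm hza)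
      omega
  by_cases hr : d % m = 0
  · by_cases hf2 : f₂ + 1 = m
    · refine CopWins.mono (CopWins.branch_of_subsingleton
        (Set.subsingleton_singleton (a := b))) (loc_subset ?_)
      rintro s z f hs hf' ⟨⟨g, ⟨hsS, hg0, hgm, hz⟩, h1, h2⟩, hD⟩
      have hmod := dist_inl_pt_mod hm1 hG hs hf' hD
      rcases hz with ⟨rfl, hz⟩ | ⟨rfl, hz⟩
      · rw [dist_inl_pt_right hm1 hG hs hf'] at hD
        omega
      · exact pt_mem_branch hm1 hs (Or.inr ⟨by omega, rfl⟩)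
    · refine hS.mono (loc_subset ?_)
      rintro s z f hs hf' ⟨⟨g, ⟨hsS, hg0, hgm, hz⟩, h1, h2⟩, hD⟩
      have hmod := dist_inl_pt_mod hm1 hG hs hf' hD
      rcases hz with ⟨rfl, hz⟩ | ⟨rfl, hz⟩
      · rw [dist_inl_pt_right hm1 hG hs hf'] at hD
        exact pt_mem_branch hm1 hs (Or.inl ⟨by omega, hsS⟩)
      · exact pt_mem_branch hm1 hs (Or.inl ⟨by omega, hsS⟩)
  · refine (copWins_knownEnd' hm hG b hS).mono (loc_subset ?_)
    rintro s z f hs hf' ⟨⟨g, ⟨hsS, hg0, hgm, hz⟩, h1, h2⟩, hD⟩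
    have hmod := dist_inl_pt_mod hm1 hG hs hf' hD
    rcases hz with ⟨rfl, hz⟩ | ⟨rfl, hz⟩
    · rw [dist_inl_pt_right hm1 hG hs hf'] at hD
      obtain rfl : d = m := by omega
      exact absurd (Nat.mod_self d) hr
    · have hf0 : f ≠ 0 ∧ f ≠ m := by
        refine ⟨?_, ?_⟩ <;> rintro rfl <;> omega
      exact mem_loc hs hf' ⟨hsS, rfl, by omega, by omega⟩

end KnownEnd

/-! ### The robber on a thread, with few matching edges left to test -/

section Threads

variable {V : Type u} {G : SimpleGraph V} {m : ℕ}

/-- The vertices covered by a set of edges, each given by an ordered pair of ends. -/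
def ends (R : Finset (V × V)) : Set V := {v | ∃ e ∈ R, v = e.1 ∨ v = e.2}

theorem mem_ends_erase [DecidableEq V] {R : Finset (V × V)} {e : V × V} {z : V} (hz : z ∈ ends R)
    (h1 : z ≠ e.1) (h2 : z ≠ e.2) : z ∈ ends (R.erase e) := by
  obtain ⟨e', he', h⟩ := hz
  refine ⟨e', Finset.mem_erase.2 ⟨?_, he'⟩, h⟩
  rintro rfl
  tauto

theorem ends_empty : ends (∅ : Finset (V × V)) = ∅ := by
  ext v
  simp [ends]

/-- What the cop relies on while the robber, coming from a vertex of `S`, is on a thread, and she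
tests the edges that he may be heading for: she wins if he comes back to `S`, and if he arrives
in `W`. Moreover, either (`t`) it does not matter which of the two happens, or she knows the
vertex he comes from; `B` is the number of rounds she has for the tests. -/
structure Setting (G : SimpleGraph V) (m : ℕ) (S W : Set V) (t : Prop) (B : ℕ) : Prop where
  winS : CopWins (subdivision G m) (branch G m S)
  winW : CopWins (subdivision G m) (branch G m W)
  cases : (t ∧ S = W ∧ B ≤ m) ∨ (¬ t ∧ (∃ x, S = {x}) ∧ B < m)

/-- The edges of `R` are edges of `G` that avoid `S` and `W`. -/
def Avoids (G : SimpleGraph V) (R : Finset (V × V)) (S W : Set V) : Prop :=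
  ∀ e ∈ R, G.Adj e.1 e.2 ∧ e.1 ∉ S ∧ e.2 ∉ S ∧ e.1 ∉ W ∧ e.2 ∉ W

theorem Avoids.mono {R R' : Finset (V × V)} {S W : Set V} (h : Avoids G R S W) (h' : R' ⊆ R) :
    Avoids G R' S W := fun e he => h e (h' he)

/-- The robber is inside a thread, at distance `f` from the end `s ∈ S` that he left last, where
`A f` holds. The other end is in `W`, or is covered by the edges of `R`, which remain to be tested;
in the latter case `f ≤ F`, and also in the former unless `t` holds. -/
def threadState (G : SimpleGraph V) (m : ℕ) (S W : Set V) (t : Prop) (R : Finset (V × V)) (F : ℕ)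
    (A : ℕ → Prop) : Set (SubdivVertex G m) :=
  loc G m fun s z f => s ∈ S ∧ 0 < f ∧ f < m ∧ A f ∧
    ((z ∈ W ∧ (t ∨ f ≤ F)) ∨ (z ∈ ends R ∧ f ≤ F))

theorem Setting.copWins_empty [Finite V] {S W : Set V} {t : Prop} {B : ℕ} (h : Setting G m S W t B)
    (hm : 3 ≤ m) (hG : G.Connected) (F : ℕ) (A : ℕ → Prop) :
    CopWins (subdivision G m) (threadState G m S W t ∅ F A) := by
  rcases h.cases with ⟨ht, rfl, -⟩ | ⟨ht, ⟨x, rfl⟩, -⟩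
  · refine (copWins_ends hm hG h.winS).mono (loc_subset ?_)
    rintro s z f hs hf ⟨hsS, h0, h1, -, hz | hz⟩
    · exact mem_loc hs hf ⟨hsS, hz.1, h0, h1⟩
    · simp [ends_empty] at hz
  · refine (copWins_knownEnd hm hG x h.winW).mono (loc_subset ?_)
    rintro s z f hs hf ⟨hsS, h0, h1, -, hz | hz⟩
    · exact mem_loc hs hf ⟨hsS, hz.1, h0, h1⟩
    · simp [ends_empty] at hz

/-- The robber is close to the vertex he comes from, and there is a round to spare. Probes at the
ends of the remaining edges then keep track of his exact position, until he is back or moves on. -/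
theorem copWins_near [Finite V] {S W : Set V} {t : Prop} {B : ℕ} (h : Setting G m S W t B)
    (hm : 12 ≤ m) (hG : G.Connected) (R : Finset (V × V)) (hR : Avoids G R S W)
    (hK : ∀ R' ⊆ R, ∀ F, 2 ≤ F → R'.card + F ≤ B →
      CopWins (subdivision G m) (threadState G m S W t R' F fun f => 2 ≤ f ∧ f + 2 ≤ m))
    {c : ℕ} (hc1 : 1 ≤ c) (hcm : c + 3 ≤ m) (hcB : R.card + c + 1 ≤ B) :
    CopWins (subdivision G m) (threadState G m S W t R c fun _ => True) := by
  classical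
  have hm1 : 1 ≤ m := by omega
  induction hn : R.card generalizing R c with
  | zero =>
    rw [Finset.card_eq_zero] at hn
    subst hn
    exact h.copWins_empty (by omega) hG _ _
  | succ n ih =>
    obtain ⟨e, he⟩ : R.Nonempty := Finset.card_pos.1 (by omega)
    have herase := Finset.card_erase_of_mem he
    obtain ⟨hab, haS, hbS, haW, hbW⟩ := hR e he
    have htS : t → S = W := fun ht => by
      rcases h.cases with h | h
      · exact h.2.1
      · exact absurd ht h.1
    refine CopWins.probe_loc hm1 (fun s z f _ hf => ⟨hf.2.1, hf.2.2.1⟩) (Sum.inl e.1) fun d => ?_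
    by_cases hd : d < m
    · refine (copWins_knownEnd' (by omega) hG e.1 h.winS).mono (loc_subset ?_)
      rintro s z f hs hf ⟨⟨g, ⟨hsS, h0, h1, -, hz⟩, h2, h3⟩, hD⟩
      have hsa : e.1 ≠ s := fun h => haS (h ▸ hsS)
      by_cases hza : z = e.1
      · subst hza
        rw [dist_inl_pt_right hm1 hG hs hf] at hD
        rcases hz with hz | hz
        · exact absurd hz.1 haW
        · exact mem_loc hs hf ⟨hsS, rfl, by omega, by omega⟩
      · have := le_dist_inl_pt hm1 hG hs hf hsa (Ne.symm hza)
        omega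
    by_cases hr : d % m = 0
    · refine h.winS.mono (loc_subset ?_)
      rintro s z f hs hf ⟨⟨g, ⟨hsS, h0, h1, -, hz⟩, h2, h3⟩, hD⟩
      have hmod := dist_inl_pt_mod hm1 hG hs hf hD
      apply pt_mem_branch hm1 hs
      rcases hz with ⟨hz, ht | hz'⟩ | ⟨hz, hz'⟩
      · rw [htS ht] at hsS ⊢
        rcases Nat.eq_zero_or_pos f with h4 | h4
        · exact Or.inl ⟨h4, hsS⟩
        · exact Or.inr ⟨by omega, hz⟩
      · exact Or.inl ⟨by omega, hsS⟩
      · exact Or.inl ⟨by omega, hsS⟩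
    by_cases hr1 : d % m = 1 ∨ d % m + 1 = m
    · have key : CopWins (subdivision G m) (loc G m fun s z f => s ∈ S ∧ 0 < f ∧ f < m ∧
          z ≠ e.1 ∧ ((z ∈ W ∧ (t ∨ f ≤ 1)) ∨ (z ∈ ends R ∧ f ≤ 1))) := by
        refine CopWins.probe_loc hm1 (fun s z f _ hf => ⟨hf.2.1, hf.2.2.1⟩) (Sum.inl e.2)
          fun d => ?_
        by_cases hd : d < m
        · refine (copWins_knownEnd' (by omega) hG e.2 h.winS).mono (loc_subset ?_)
          rintro s z f hs hf ⟨⟨g, ⟨hsS, h0, h1, -, hz⟩, h2, h3⟩, hD⟩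
          have hsb : e.2 ≠ s := fun h => hbS (h ▸ hsS)
          by_cases hzb : z = e.2
          · subst hzb
            rw [dist_inl_pt_right hm1 hG hs hf] at hD
            rcases hz with hz | hz
            · exact absurd hz.1 hbW
            · exact mem_loc hs hf ⟨hsS, rfl, by omega, by omega⟩
          · have := le_dist_inl_pt hm1 hG hs hf hsb (Ne.symm hzb)
            omega
        by_cases hr : d % m = 0
        · refine h.winS.mono (loc_subset ?_)
          rintro s z f hs hf ⟨⟨g, ⟨hsS, h0, h1, -, hz⟩, h2, h3⟩, hD⟩
          have hmod := dist_inl_pt_mod hm1 hG hs hf hD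
          apply pt_mem_branch hm1 hs
          rcases hz with ⟨hz, ht | hz'⟩ | ⟨hz, hz'⟩
          · rw [htS ht] at hsS ⊢
            rcases Nat.eq_zero_or_pos f with h4 | h4
            · exact Or.inl ⟨h4, hsS⟩
            · exact Or.inr ⟨by omega, hz⟩
          · exact Or.inl ⟨by omega, hsS⟩
          · exact Or.inl ⟨by omega, hsS⟩
        by_cases hr1 : d % m = 1 ∨ d % m + 1 = m
        · refine (ih (R.erase e) (hR.mono (Finset.erase_subset _ _))
            (fun R' hR' => hK R' (hR'.trans (Finset.erase_subset _ _)))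
            (c := 1) le_rfl (by omega) (by omega) (by omega)).mono (loc_subset ?_)
          rintro s z f hs hf ⟨⟨g, ⟨hsS, h0, h1, hza, hz⟩, h2, h3⟩, hD⟩
          have hmod := dist_inl_pt_mod hm1 hG hs hf hD
          have hzb : z ≠ e.2 := by
            rintro rfl
            rw [dist_inl_pt_right hm1 hG hs hf] at hD
            omega
          refine mem_loc hs hf ⟨hsS, by omega, by omega, trivial, ?_⟩
          rcases hz with ⟨hz, ht | hz'⟩ | ⟨hz, hz'⟩
          · exact Or.inl ⟨hz, Or.inl ht⟩
          · exact Or.inl ⟨hz, Or.inr (by omega)⟩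
          · exact Or.inr ⟨mem_ends_erase hz hza hzb, by omega⟩
        · refine (hK R subset_rfl 2 le_rfl (by omega)).mono (loc_subset ?_)
          rintro s z f hs hf ⟨⟨g, ⟨hsS, h0, h1, hza, hz⟩, h2, h3⟩, hD⟩
          have hmod := dist_inl_pt_mod hm1 hG hs hf hD
          refine mem_loc hs hf ⟨hsS, by omega, by omega, by omega, ?_⟩
          rcases hz with ⟨hz, ht | hz'⟩ | ⟨hz, hz'⟩
          · exact Or.inl ⟨hz, Or.inl ht⟩
          · exact Or.inl ⟨hz, Or.inr (by omega)⟩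
          · exact Or.inr ⟨hz, by omega⟩
      refine key.mono (loc_subset ?_)
      rintro s z f hs hf ⟨⟨g, ⟨hsS, h0, h1, -, hz⟩, h2, h3⟩, hD⟩
      have hmod := dist_inl_pt_mod hm1 hG hs hf hD
      have hza : z ≠ e.1 := by
        rintro rfl
        rw [dist_inl_pt_right hm1 hG hs hf] at hD
        omega
      refine mem_loc hs hf ⟨hsS, by omega, by omega, hza, ?_⟩
      rcases hz with ⟨hz, ht | hz'⟩ | ⟨hz, hz'⟩
      · exact Or.inl ⟨hz, Or.inl ht⟩
      · exact Or.inl ⟨hz, Or.inr (by omega)⟩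
      · exact Or.inr ⟨hz, by omega⟩
    · refine (hK R subset_rfl (c + 1) (by omega) (by omega)).mono (loc_subset ?_)
      rintro s z f hs hf ⟨⟨g, ⟨hsS, h0, h1, -, hz⟩, h2, h3⟩, hD⟩
      have hmod := dist_inl_pt_mod hm1 hG hs hf hD
      refine mem_loc hs hf ⟨hsS, by omega, by omega, by omega, ?_⟩
      rcases hz with ⟨hz, ht | hz'⟩ | ⟨hz, hz'⟩
      · exact Or.inl ⟨hz, Or.inl ht⟩
      · exact Or.inl ⟨hz, Or.inr (by omega)⟩
      · exact Or.inr ⟨hz, by omega⟩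

/-- A probe at distance 3 from `a` on the thread `ab`, when the robber is close to an end of his
thread: a small result reveals that this thread ends in `a` or `b`. -/
theorem copWins_of_dist_le [Finite V] (hm : 12 ≤ m) (hG : G.Connected) {S : Set V}
    (hS : CopWins (subdivision G m) (branch G m S)) {a b : V} (hab : G.Adj a b) (ha : a ∉ S)
    (hb : b ∉ S) {d : ℕ} (hd : d ≤ m + 2) :
    CopWins (subdivision G m) (loc G m fun s z f => s ∈ S ∧ (f ≤ 4 ∨ m ≤ f + 4) ∧
      (subdivision G m).dist (pt G m a b 3) (pt G m s z f) = d) := by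
  have hm1 : 1 ≤ m := by omega
  have facts : ∀ s z f, G.Adj s z → f ≤ m → s ∈ S → (f ≤ 4 ∨ m ≤ f + 4) →
      (subdivision G m).dist (pt G m a b 3) (pt G m s z f) = d →
      f ≠ 0 ∧ ((z = a ∧ d = 3 + (m - f)) ∨ (z = b ∧ d = (m - 3) + (m - f) ∧ m ≤ f + 4)) := by
    intro s z f hs hf hsS hf4 hD
    have hsa : s ≠ a := fun h => ha (h ▸ hsS)
    have hsb : s ≠ b := fun h => hb (h ▸ hsS)
    by_cases hza : z = a
    · subst hza
      rw [dist_pt_pt_fst hm1 hG hab hs hsb (by omega) hf] at hD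
      exact ⟨by omega, Or.inl ⟨rfl, by omega⟩⟩
    by_cases hzb : z = b
    · subst hzb
      have := dist_pt_pt_snd hm1 hG hab hs hsa (j := 3) (by omega) hf
      exact ⟨by omega, Or.inr ⟨rfl, by omega, by omega⟩⟩
    · have := le_dist_pt_pt hm1 hG hab hs hsa hsb hza hzb (j := 3) (by omega) hf
      omega
  by_cases hd3 : d = 3
  · refine CopWins.mono (CopWins.branch_of_subsingleton
      (Set.subsingleton_singleton (a := a))) (loc_subset ?_)
    rintro s z f hs hf ⟨hsS, hf4, hD⟩
    rcases facts s z f hs hf hsS hf4 hD with ⟨h0, ⟨rfl, h1⟩ | ⟨rfl, h1, h2⟩⟩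
    · exact pt_mem_branch hm1 hs (Or.inr ⟨by omega, rfl⟩)
    · omega
  by_cases hd3' : d = m - 3
  · refine CopWins.mono (CopWins.branch_of_subsingleton
      (Set.subsingleton_singleton (a := b))) (loc_subset ?_)
    rintro s z f hs hf ⟨hsS, hf4, hD⟩
    rcases facts s z f hs hf hsS hf4 hD with ⟨h0, ⟨rfl, h1⟩ | ⟨rfl, h1, h2⟩⟩
    · omega
    · exact pt_mem_branch hm1 hs (Or.inr ⟨by omega, rfl⟩)
  refine (copWins_twoEnds (by omega) hG hS hab.ne ha (f₁ := m + 3 - d) (f₂ := 2 * m - 3 - d)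
    (by omega)).mono (loc_subset ?_)
  rintro s z f hs hf ⟨hsS, hf4, hD⟩
  rcases facts s z f hs hf hsS hf4 hD with ⟨h0, ⟨rfl, h1⟩ | ⟨rfl, h1, h2⟩⟩
  · exact mem_loc hs hf ⟨hsS, by omega, by omega, Or.inl ⟨rfl, by omega⟩⟩
  · exact mem_loc hs hf ⟨hsS, by omega, by omega, Or.inr ⟨rfl, by omega⟩⟩

/-- The robber is within distance `c` of an end of his thread. The end `s` is in `S`. The end `z`
is in `S`, or covered by `R₁` if `s` is the end close by, or covered by `R₂`, with `f ≤ top`, if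
`z` is. -/
def endState (G : SimpleGraph V) (m : ℕ) (S : Set V) (R₁ R₂ : Finset (V × V)) (c top : ℕ) :
    Set (SubdivVertex G m) :=
  loc G m fun s z f => s ∈ S ∧ 0 < f ∧ f < m ∧ ((z ∈ S ∧ (f ≤ c ∨ m ≤ f + c)) ∨
    (z ∈ ends R₁ ∧ f ≤ c) ∨ (z ∈ ends R₂ ∧ m ≤ f + c ∧ f ≤ top))

/-- Testing an edge when the robber is near an end of his thread, but it is not known whether he
has returned or is about to arrive. -/
theorem copWins_endState [Finite V] [DecidableEq V] (hm : 12 ≤ m) (hG : G.Connected) {S : Set V}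
    (hS : CopWins (subdivision G m) (branch G m S)) {R₁ R₂ : Finset (V × V)} {e : V × V}
    (he : G.Adj e.1 e.2 ∧ e.1 ∉ S ∧ e.2 ∉ S) {c top : ℕ} (hc : c ≤ 3)
    (htop : top + 2 ≤ m ∨ R₂.erase e = ∅)
    (hnext : CopWins (subdivision G m) (endState G m S R₁ (R₂.erase e) (c + 1) m)) :
    CopWins (subdivision G m) (endState G m S R₁ R₂ c top) := by
  have hm1 : 1 ≤ m := by omega
  obtain ⟨hab, ha, hb⟩ := he
  refine CopWins.probe_loc hm1 (fun s z f _ hf => ⟨hf.2.1, hf.2.2.1⟩) (pt G m e.1 e.2 3)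
    fun d => ?_
  by_cases hd : d ≤ m + 2
  · refine (copWins_of_dist_le hm hG hS hab ha hb hd).mono (loc_subset ?_)
    rintro s z f hs hf ⟨⟨g, ⟨hsS, h0, h1, hz⟩, h2, h3⟩, hD⟩
    exact mem_loc hs hf ⟨hsS, by omega, hD⟩
  -- If the robber is about to arrive, then the thread does not end in `e`.
  have facts : ∀ s z f g, G.Adj s z → f ≤ m → s ∈ S → f ≤ g + 1 → g ≤ f + 1 →
      (subdivision G m).dist (pt G m e.1 e.2 3) (pt G m s z f) = d → z ∈ ends R₂ → m ≤ g + c →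
      z ∈ ends (R₂.erase e) := by
    intro s z f g hs hf hsS h3 h2 hD hz hg
    have hsa : s ≠ e.1 := fun h => ha (h ▸ hsS)
    have hsb : s ≠ e.2 := fun h => hb (h ▸ hsS)
    apply mem_ends_erase hz
    · rintro rfl
      rw [dist_pt_pt_fst hm1 hG hab hs hsb (by omega) hf] at hD
      omega
    · rintro rfl
      have := dist_pt_pt_snd hm1 hG hab hs hsa (j := 3) (by omega) hf
      omega
  by_cases hr : d % m = 3 ∨ d % m + 3 = m
  · refine hS.mono (loc_subset ?_)
    rintro s z f hs hf ⟨⟨g, ⟨hsS, h0, h1, hz⟩, h2, h3⟩, hD⟩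
    have hsa : s ≠ e.1 := fun h => ha (h ▸ hsS)
    have hsb : s ≠ e.2 := fun h => hb (h ▸ hsS)
    obtain ⟨w, hw, hw', hlt⟩ := dist_pt_pt_mod hm1 hG hab hs hsa hsb (by omega) hf hD
    apply pt_mem_branch hm1 hs
    rcases hz with ⟨hz, hg⟩ | ⟨hz, hg⟩ | ⟨hz, hg, hgt⟩
    · rcases Nat.eq_zero_or_pos f with h4 | h4
      · exact Or.inl ⟨h4, hsS⟩
      · refine Or.inr ⟨?_, hz⟩
        omega
    · exact Or.inl ⟨by omega, hsS⟩
    · have hz' := facts s z f g hs hf hsS h3 h2 hD hz hg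
      rcases htop with htop | htop
      · exfalso
        omega
      · simp [htop, ends_empty] at hz'
  · refine hnext.mono (loc_subset ?_)
    rintro s z f hs hf ⟨⟨g, ⟨hsS, h0, h1, hz⟩, h2, h3⟩, hD⟩
    have hsa : s ≠ e.1 := fun h => ha (h ▸ hsS)
    have hsb : s ≠ e.2 := fun h => hb (h ▸ hsS)
    obtain ⟨w, hw, hw', hlt⟩ := dist_pt_pt_mod hm1 hG hab hs hsa hsb (by omega) hf hD
    have hf0 : f ≠ 0 ∧ f ≠ m := by
      refine ⟨?_, ?_⟩ <;> rintro rfl <;> omega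
    refine mem_loc hs hf ⟨hsS, by omega, by omega, ?_⟩
    rcases hz with ⟨hz, hg⟩ | ⟨hz, hg⟩ | ⟨hz, hg, hgt⟩
    · exact Or.inl ⟨hz, by omega⟩
    · exact Or.inr (Or.inl ⟨hz, by omega⟩)
    · exact Or.inr (Or.inr ⟨facts s z f g hs hf hsS h3 h2 hD hz hg, by omega, by omega⟩)

end Threads

/-! ### The robber crossing a thread -/

section Crossing

variable {V : Type u} {G : SimpleGraph V} {m : ℕ}

/-- The robber is near an end of his thread, and at most as many edges remain to be tested as
there are rounds until he may arrive; the cop wins if she wins whenever he is at distance at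
least two from the ends of his thread, with no more edges to be tested. -/
theorem copWins_nearEnds [Finite V] {S W : Set V} {t : Prop} {B : ℕ} (h : Setting G m S W t B)
    (hm : 12 ≤ m) (hG : G.Connected) (R : Finset (V × V)) (hR : Avoids G R S W)
    (hK : ∀ R' ⊆ R, ∀ F, 2 ≤ F → R'.card + F ≤ B →
      CopWins (subdivision G m) (threadState G m S W t R' F fun f => 2 ≤ f ∧ f + 2 ≤ m))
    {F : ℕ} (hF3 : 3 ≤ F) (hFm : F + 1 ≤ m) (hFB : R.card + F ≤ B) :
    CopWins (subdivision G m) (threadState G m S W t R F fun f => f ≤ 2 ∨ m ≤ f + 2) := by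
  classical
  have hm1 : 1 ≤ m := by omega
  have hnear := fun {c : ℕ} => copWins_near h hm hG R hR hK (c := c)
  rcases R.eq_empty_or_nonempty with rfl | ⟨e, he⟩
  · exact h.copWins_empty (by omega) hG _ _
  have hpos : 0 < R.card := Finset.card_pos.2 ⟨e, he⟩
  have herase := Finset.card_erase_of_mem he
  have hBm : B ≤ m := by
    rcases h.cases with h | h
    · exact h.2.2
    · exact h.2.2.le
  by_cases hF : F + 3 ≤ m
  · refine (hnear (c := 2) (by omega) (by omega) (by omega)).mono (loc_subset ?_)
    rintro s z f hs hf ⟨hsS, h0, h1, hA, hz⟩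
    refine mem_loc hs hf ⟨hsS, h0, h1, trivial, ?_⟩
    rcases hz with ⟨hz, ht | hz'⟩ | ⟨hz, hz'⟩
    · exact Or.inl ⟨hz, Or.inl ht⟩
    · exact Or.inl ⟨hz, Or.inr (by omega)⟩
    · exact Or.inr ⟨hz, by omega⟩
  rcases h.cases with ⟨ht, rfl, -⟩ | ⟨ht, ⟨x, rfl⟩, hBm'⟩
  · -- Once the far ends are ruled out, the robber can only be near the vertex he comes from.
    have hlast : ∀ c ≤ 4, 3 ≤ c → ∀ top,
        CopWins (subdivision G m) (endState G m S R ∅ c top) := by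
      intro c hc4 hc3 top
      refine (hnear (c := c) (by omega) (by omega) (by omega)).mono (loc_subset ?_)
      rintro s z f hs hf ⟨hsS, h0, h1, hz⟩
      refine mem_loc hs hf ⟨hsS, h0, h1, trivial, ?_⟩
      rcases hz with ⟨hz, -⟩ | ⟨hz, hz'⟩ | ⟨hz, hz'⟩
      · exact Or.inl ⟨hz, Or.inl ht⟩
      · exact Or.inr ⟨hz, hz'⟩
      · simp [ends_empty] at hz
    have hav : ∀ e ∈ R, G.Adj e.1 e.2 ∧ e.1 ∉ S ∧ e.2 ∉ S := fun e he =>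
      ⟨(hR e he).1, (hR e he).2.1, (hR e he).2.2.1⟩
    have hstart : CopWins (subdivision G m) (endState G m S R R 2 F) := by
      rcases (R.erase e).eq_empty_or_nonempty with hemp | ⟨e', he'⟩
      · exact copWins_endState hm hG h.winS (hav e he) (by omega) (Or.inr hemp)
          (hemp ▸ hlast 3 (by omega) le_rfl m)
      · have herase' := Finset.card_erase_of_mem he'
        have hpos' : 0 < (R.erase e).card := Finset.card_pos.2 ⟨e', he'⟩
        have hemp : (R.erase e).erase e' = ∅ := Finset.card_eq_zero.1 (by omega)
        exact copWins_endState hm hG h.winS (hav e he) (by omega) (Or.inl (by omega))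
          (copWins_endState hm hG h.winS (hav e' (Finset.mem_of_mem_erase he')) le_rfl
            (Or.inr hemp) (hemp ▸ hlast 4 le_rfl (by omega) m))
    refine hstart.mono (loc_subset ?_)
    rintro s z f hs hf ⟨hsS, h0, h1, hA, hz⟩
    refine mem_loc hs hf ⟨hsS, h0, h1, ?_⟩
    rcases hz with ⟨hz, -⟩ | ⟨hz, hz'⟩
    · exact Or.inl ⟨hz, hA⟩
    · rcases hA with hA | hA
      · exact Or.inr (Or.inl ⟨hz, hA⟩)
      · exact Or.inr (Or.inr ⟨hz, hA, hz'⟩)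
  · -- A probe at the known vertex `x` gives the exact position; at most one edge is left.
    obtain ⟨hab, ha, hb, haW, hbW⟩ := hR e he
    have hRe : R.erase e = ∅ := Finset.card_eq_zero.1 (by omega)
    have hFm' : F + 2 = m := by omega
    refine CopWins.probe_loc hm1 (fun s z f _ hf => ⟨hf.2.1, hf.2.2.1⟩) (Sum.inl x) fun d => ?_
    have key : ∀ s z f, G.Adj s z → f ≤ m → ((∃ g, (s ∈ ({x} : Set V) ∧ 0 < g ∧ g < m ∧
        (g ≤ 2 ∨ m ≤ g + 2) ∧ ((z ∈ W ∧ (t ∨ g ≤ F)) ∨ (z ∈ ends R ∧ g ≤ F))) ∧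
        g ≤ f + 1 ∧ f ≤ g + 1) ∧ (subdivision G m).dist (Sum.inl x) (pt G m s z f) = d) →
        s = x ∧ f = d ∧ f < m ∧ (f ≤ 3 ∨ m ≤ f + 3) ∧ (z ∈ W ∨ z ∈ ends R) := by
      rintro s z f hs hf ⟨⟨g, ⟨rfl, h0, h1, hA, hz⟩, h2, h3⟩, hD⟩
      rw [dist_inl_pt_left hm1 hG hs hf] at hD
      refine ⟨rfl, hD, ?_⟩
      rcases hz with ⟨hz, ht' | hz'⟩ | ⟨hz, hz'⟩
      · exact absurd ht' ht
      · exact ⟨by omega, by omega, Or.inl hz⟩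
      · exact ⟨by omega, by omega, Or.inr hz⟩
    by_cases hd0 : d = 0
    · refine h.winS.mono (loc_subset ?_)
      intro s z f hs hf hP
      obtain ⟨rfl, rfl, -⟩ := key s z f hs hf hP
      exact pt_mem_branch hm1 hs (Or.inl ⟨hd0, rfl⟩)
    by_cases hd3 : d ≤ 3
    · have htarget : CopWins (subdivision G m) (loc G m fun s z f =>
          s = x ∧ f = d ∧ (z ∈ W ∨ z ∈ ends R)) := by
        by_cases hd1 : d = 1
        · refine (hnear (c := 1) le_rfl (by omega) (by omega)).mono (loc_subset ?_)
          rintro s z f hs hf ⟨rfl, rfl, hz⟩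
          refine mem_loc hs hf ⟨rfl, by omega, by omega, trivial, ?_⟩
          exact hz.imp (fun hz => ⟨hz, Or.inr (by omega)⟩) fun hz => ⟨hz, by omega⟩
        · refine (hK R subset_rfl d (by omega) (by omega)).mono (loc_subset ?_)
          rintro s z f hs hf ⟨rfl, rfl, hz⟩
          refine mem_loc hs hf ⟨rfl, by omega, by omega, ⟨by omega, by omega⟩, ?_⟩
          exact hz.imp (fun hz => ⟨hz, Or.inr (by omega)⟩) fun hz => ⟨hz, by omega⟩
      refine htarget.mono (loc_subset ?_)
      intro s z f hs hf hP
      obtain ⟨h1, h2, -, -, h3⟩ := key s z f hs hf hP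
      exact mem_loc hs hf ⟨h1, h2, h3⟩
    by_cases hdm : d < m
    swap
    · refine CopWins.of_subsingleton (Set.subsingleton_empty.anti (loc_subset ?_))
      intro s z f hs hf hP
      obtain ⟨-, h2, h3, -⟩ := key s z f hs hf hP
      omega
    have hfar : CopWins (subdivision G m) (loc G m fun s z f =>
        s = x ∧ f = d ∧ (f ≤ 3 ∨ m ≤ f + 3) ∧ (z ∈ W ∨ z ∈ ends R)) := by
      refine CopWins.probe_loc hm1 (by rintro s z f - ⟨-, rfl, -⟩; omega) (pt G m e.1 e.2 3)
        fun d' => ?_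
      by_cases hd' : d' ≤ m + 2
      · refine (copWins_of_dist_le hm hG h.winS hab ha hb hd').mono (loc_subset ?_)
        rintro s z f hs hf ⟨⟨g, ⟨hsx, hgd, hg, hz⟩, h2, h3⟩, hD⟩
        exact mem_loc hs hf ⟨hsx, by omega, hD⟩
      have facts : ∀ s z f, G.Adj s z → f ≤ m → ((∃ g, (s = x ∧ g = d ∧
          (g ≤ 3 ∨ m ≤ g + 3) ∧ (z ∈ W ∨ z ∈ ends R)) ∧ g ≤ f + 1 ∧ f ≤ g + 1) ∧
          (subdivision G m).dist (pt G m e.1 e.2 3) (pt G m s z f) = d') →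
          s = x ∧ z ∈ W ∧ m ≤ f + 4 ∧ (f = m ↔ d' % m = 3 ∨ d' % m + 3 = m) := by
        rintro s z f hs hf ⟨⟨g, ⟨rfl, hgd, hg, hz⟩, h2, h3⟩, hD⟩
        have hsa : s ≠ e.1 := fun h => ha h.symm
        have hsb : s ≠ e.2 := fun h => hb h.symm
        obtain ⟨w, hw, hw', hlt⟩ := dist_pt_pt_mod hm1 hG hab hs hsa hsb (by omega) hf hD
        refine ⟨rfl, ?_, by omega, by omega⟩
        rcases hz with hz | hz
        · exact hz
        exfalso
        have hz' : z ∉ ends (R.erase e) := by simp [hRe, ends_empty]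
        apply hz'
        apply mem_ends_erase hz
        · rintro rfl
          rw [dist_pt_pt_fst hm1 hG hab hs hsb (by omega) hf] at hD
          omega
        · rintro rfl
          have := dist_pt_pt_snd hm1 hG hab hs hsa (j := 3) (by omega) hf
          omega
      by_cases hr : d' % m = 3 ∨ d' % m + 3 = m
      · refine h.winW.mono (loc_subset ?_)
        intro s z f hs hf hP
        obtain ⟨-, h2, -, h4⟩ := facts s z f hs hf hP
        exact pt_mem_branch hm1 hs (Or.inr ⟨h4.2 hr, h2⟩)
      · refine (copWins_knownEnd (by omega) hG x h.winW).mono (loc_subset ?_)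
        intro s z f hs hf hP
        obtain ⟨h1, h2, h3, h4⟩ := facts s z f hs hf hP
        have h5 : f ≠ m := fun h => hr (h4.1 h)
        exact mem_loc hs hf ⟨h1, h2, by omega, by omega⟩
    refine hfar.mono (loc_subset ?_)
    intro s z f hs hf hP
    obtain ⟨h1, h2, -, h3, h4⟩ := key s z f hs hf hP
    exact mem_loc hs hf ⟨h1, h2, h3, h4⟩

/-- The robber is at distance at least two from both ends of his thread. The cop tests the
remaining edges one by one, with probes in the middle of their threads. -/
theorem copWins_crossing [Finite V] {S W : Set V} {t : Prop} {B : ℕ} (h : Setting G m S W t B)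
    (hm : 12 ≤ m) (hG : G.Connected) (R : Finset (V × V)) (hR : Avoids G R S W) {F : ℕ}
    (hF2 : 2 ≤ F) (hFB : R.card + F ≤ B) :
    CopWins (subdivision G m) (threadState G m S W t R F fun f => 2 ≤ f ∧ f + 2 ≤ m) := by
  classical
  have hm1 : 1 ≤ m := by omega
  induction hn : R.card using Nat.strong_induction_on generalizing R F with
  | _ n ih =>
  rcases R.eq_empty_or_nonempty with rfl | ⟨e, he⟩
  · exact h.copWins_empty (by omega) hG _ _
  have hpos : 0 < R.card := Finset.card_pos.2 ⟨e, he⟩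
  have herase := Finset.card_erase_of_mem he
  obtain ⟨hab, ha, hb, haW, hbW⟩ := hR e he
  have hBm : B ≤ m := by
    rcases h.cases with h | h
    · exact h.2.2
    · exact h.2.2.le
  -- As the robber is at distance at least two from `z`, the bound `F` may be lowered to `m - 2`.
  obtain ⟨F', hF'2, hF'm, hF'F, hF'⟩ : ∃ F', 2 ≤ F' ∧ F' + 2 ≤ m ∧ F' ≤ F ∧
      ∀ f, f + 2 ≤ m → f ≤ F → f ≤ F' :=
    ⟨min F (m - 2), by omega, by omega, by omega, fun f h1 h2 => by omega⟩
  have hRe : Avoids G (R.erase e) S W := hR.mono (Finset.erase_subset _ _)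
  have hK : ∀ R' ⊆ R.erase e, ∀ F, 2 ≤ F → R'.card + F ≤ B →
      CopWins (subdivision G m) (threadState G m S W t R' F fun f => 2 ≤ f ∧ f + 2 ≤ m) := by
    intro R' hR' F hF hFB
    have := Finset.card_le_card hR'
    exact ih R'.card (by omega) R' (hRe.mono hR') hF hFB rfl
  obtain ⟨j, ε, hj, hε⟩ : ∃ j ε, m = 2 * j + ε ∧ ε ≤ 1 :=
    ⟨m / 2, m % 2, (Nat.div_add_mod m 2).symm, by omega⟩
  refine CopWins.probe_loc hm1 (fun s z f _ hf => ⟨hf.2.1, hf.2.2.1⟩) (pt G m e.1 e.2 j)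
    fun d => ?_
  by_cases hd : d ≤ m + j
  · refine (copWins_twoEnds (by omega) hG h.winS hab.ne ha (f₁ := m + j - d)
      (f₂ := m + j - d + ε) (by omega)).mono (loc_subset ?_)
    rintro s z f hs hf ⟨⟨g, ⟨hsS, h0, h1, hA, hz⟩, h2, h3⟩, hD⟩
    have hsa : s ≠ e.1 := fun h => ha (h ▸ hsS)
    have hsb : s ≠ e.2 := fun h => hb (h ▸ hsS)
    refine mem_loc hs hf ⟨hsS, by omega, by omega, ?_⟩
    by_cases hza : z = e.1
    · subst hza
      rw [dist_pt_pt_fst hm1 hG hab hs hsb (by omega) hf] at hD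
      exact Or.inl ⟨rfl, by omega⟩
    by_cases hzb : z = e.2
    · subst hzb
      have := dist_pt_pt_snd hm1 hG hab hs hsa (j := j) (by omega) hf
      exact Or.inr ⟨rfl, by omega⟩
    · have := le_dist_pt_pt hm1 hG hab hs hsa hsb hza hzb (j := j) (by omega) hf
      omega
  have facts : ∀ s z f, G.Adj s z → f ≤ m → ((∃ g, (s ∈ S ∧ 0 < g ∧ g < m ∧
      (2 ≤ g ∧ g + 2 ≤ m) ∧ ((z ∈ W ∧ (t ∨ g ≤ F)) ∨ (z ∈ ends R ∧ g ≤ F))) ∧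
      g ≤ f + 1 ∧ f ≤ g + 1) ∧
      (subdivision G m).dist (pt G m e.1 e.2 j) (pt G m s z f) = d) →
      s ∈ S ∧ 0 < f ∧ f < m ∧ ((z ∈ W ∧ (t ∨ f ≤ F' + 1)) ∨
        (z ∈ ends (R.erase e) ∧ f ≤ F' + 1)) ∧
      ((j ≤ d % m + 1 ∧ d % m ≤ j + 1 + ε → f ≤ 2 ∨ m ≤ f + 2) ∧
      (¬ (j ≤ d % m + 1 ∧ d % m ≤ j + 1 + ε) → 2 ≤ f ∧ f + 2 ≤ m)) := by
    rintro s z f hs hf ⟨⟨g, ⟨hsS, h0, h1, hA, hz⟩, h2, h3⟩, hD⟩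
    have hsa : s ≠ e.1 := fun h => ha (h ▸ hsS)
    have hsb : s ≠ e.2 := fun h => hb (h ▸ hsS)
    have hza : z ≠ e.1 := by
      rintro rfl
      rw [dist_pt_pt_fst hm1 hG hab hs hsb (by omega) hf] at hD
      omega
    have hzb : z ≠ e.2 := by
      rintro rfl
      have := dist_pt_pt_snd hm1 hG hab hs hsa (j := j) (by omega) hf
      omega
    obtain ⟨w, hw, hw', hlt⟩ := dist_pt_pt_mod hm1 hG hab hs hsa hsb (by omega) hf hD
    refine ⟨hsS, by omega, by omega, ?_, ?_⟩
    · rcases hz with ⟨hz, ht | hz'⟩ | ⟨hz, hz'⟩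
      · exact Or.inl ⟨hz, Or.inl ht⟩
      · exact Or.inl ⟨hz, Or.inr (by have := hF' g hA.2 hz'; omega)⟩
      · exact Or.inr ⟨mem_ends_erase hz hza hzb, by have := hF' g hA.2 hz'; omega⟩
    · clear hD hz hF' ih hK
      constructor <;> intro hr <;> omega
  by_cases hr : j ≤ d % m + 1 ∧ d % m ≤ j + 1 + ε
  · refine (copWins_nearEnds h hm hG (R.erase e) hRe hK (F := F' + 1) (by omega) (by omega)
      (by omega)).mono (loc_subset ?_)
    intro s z f hs hf hP
    obtain ⟨h1, h2, h3, h4, h5⟩ := facts s z f hs hf hP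
    exact mem_loc hs hf ⟨h1, h2, h3, h5.1 hr, h4⟩
  · refine (hK (R.erase e) subset_rfl (F' + 1) (by omega) (by omega)).mono (loc_subset ?_)
    intro s z f hs hf hP
    obtain ⟨h1, h2, h3, h4, h5⟩ := facts s z f hs hf hP
    exact mem_loc hs hf ⟨h1, h2, h3, h5.2 hr, h4⟩

end Crossing

/-! ### The robber leaving a vertex -/

section Leaving

variable {V : Type u} {G : SimpleGraph V} {m : ℕ}

theorem dist_inl_inl (hm : 1 ≤ m) (hG : G.Connected) (v s : V) :
    (subdivision G m).dist (Sum.inl v) (Sum.inl s) = m * G.dist v s := by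
  by_cases hsv : s = v
  · subst hsv
    rw [SimpleGraph.dist_self, SimpleGraph.dist_self, Nat.mul_zero]
  · obtain ⟨p⟩ := hG.preconnected s v
    cases p with
    | nil => exact absurd rfl hsv
    | cons hadj p =>
      rw [← pt_zero hm s, dist_inl_pt hm hG v hadj (Nat.zero_le m)]
      have := mul_dist_le (m := m) hG hadj v
      omega

/-- The robber has just left `S`, or is on a thread to `v`: a probe at `v` tells which, and spends
one round of the budget. -/
theorem copWins_probeVertex [Finite V] {S W : Set V} {t : Prop} {B : ℕ} (h : Setting G m S W t B)
    (hm : 12 ≤ m) (hG : G.Connected) {R : Finset (V × V)} (hR : Avoids G R S W)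
    (hRB : R.card + 2 ≤ B) {v : V} (hv : v ∉ S) :
    CopWins (subdivision G m) (loc G m fun s z f =>
      s ∈ S ∧ 0 < f ∧ f ≤ 2 ∧ (z = v ∨ (f = 1 ∧ (z ∈ W ∨ z ∈ ends R)))) := by
  have hm1 : 1 ≤ m := by omega
  have hK : ∀ R' ⊆ R, ∀ F, 2 ≤ F → R'.card + F ≤ B →
      CopWins (subdivision G m) (threadState G m S W t R' F fun f => 2 ≤ f ∧ f + 2 ≤ m) :=
    fun R' hR' F hF hB => copWins_crossing h hm hG R' (hR.mono hR') hF hB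
  refine CopWins.probe_loc hm1 (by rintro s z f - ⟨-, h0, h1, -⟩; omega) (Sum.inl v) fun d => ?_
  have key : ∀ s z f, G.Adj s z → f ≤ m → ((∃ g, (s ∈ S ∧ 0 < g ∧ g ≤ 2 ∧
      (z = v ∨ (g = 1 ∧ (z ∈ W ∨ z ∈ ends R)))) ∧ g ≤ f + 1 ∧ f ≤ g + 1) ∧
      (subdivision G m).dist (Sum.inl v) (pt G m s z f) = d) →
      s ∈ S ∧ f ≤ 3 ∧ (d % m = f ∨ d % m + f = m) ∧ d % m < m ∧
      ((z = v ∧ d = m - f) ∨ (m ≤ d ∧ f ≤ 2 ∧ (z ∈ W ∨ z ∈ ends R))) := by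
    rintro s z f hs hf ⟨⟨g, ⟨hsS, h0, h1, hz⟩, h2, h3⟩, hD⟩
    have hmod := dist_inl_pt_mod hm1 hG hs hf hD
    refine ⟨hsS, by omega, hmod.1, hmod.2, ?_⟩
    have hsv : v ≠ s := fun h => hv (h ▸ hsS)
    by_cases hzv : z = v
    · subst hzv
      rw [dist_inl_pt_right hm1 hG hs hf] at hD
      exact Or.inl ⟨rfl, hD.symm⟩
    · have := le_dist_inl_pt hm1 hG hs hf hsv (Ne.symm hzv)
      obtain ⟨hg, hz⟩ := hz.resolve_left hzv
      exact Or.inr ⟨by omega, by omega, hz⟩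
  by_cases hd : d < m
  · refine (copWins_knownEnd' (by omega) hG v h.winS).mono (loc_subset ?_)
    intro s z f hs hf hP
    obtain ⟨hsS, hf3, hmod, hlt, hz⟩ := key s z f hs hf hP
    rcases hz with ⟨hz, hdf⟩ | hz
    · exact mem_loc hs hf ⟨hsS, hz, by omega, by omega⟩
    · omega
  by_cases hr : d % m = 0
  · refine h.winS.mono (loc_subset ?_)
    intro s z f hs hf hP
    obtain ⟨hsS, hf3, hmod, hlt, hz⟩ := key s z f hs hf hP
    exact pt_mem_branch hm1 hs (Or.inl ⟨by omega, hsS⟩)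
  by_cases hr1 : d % m = 1 ∨ d % m + 1 = m
  · refine (copWins_near h hm hG R hR hK (c := 1) le_rfl (by omega) (by omega)).mono
      (loc_subset ?_)
    intro s z f hs hf hP
    obtain ⟨hsS, hf3, hmod, hlt, hz⟩ := key s z f hs hf hP
    rcases hz with ⟨hz, hdf⟩ | ⟨-, hf2, hz⟩
    · omega
    · exact mem_loc hs hf ⟨hsS, by omega, by omega, trivial,
        hz.imp (fun hz => ⟨hz, Or.inr (by omega)⟩) fun hz => ⟨hz, by omega⟩⟩
  · refine (hK R subset_rfl 2 le_rfl (by omega)).mono (loc_subset ?_)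
    intro s z f hs hf hP
    obtain ⟨hsS, hf3, hmod, hlt, hz⟩ := key s z f hs hf hP
    rcases hz with ⟨hz, hdf⟩ | ⟨-, hf2, hz⟩
    · omega
    · exact mem_loc hs hf ⟨hsS, by omega, by omega, ⟨by omega, by omega⟩,
        hz.imp (fun hz => ⟨hz, Or.inr (by omega)⟩) fun hz => ⟨hz, by omega⟩⟩

/-- The robber has just left a set of vertices with the same neighbours. As those have equal
distances to every other vertex, one probe deals with the first edge, and one round is saved. -/
theorem copWins_twins [Finite V] {S W : Set V} {t : Prop} {B : ℕ} (h : Setting G m S W t B)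
    (hm : 12 ≤ m) (hG : G.Connected) {R : Finset (V × V)} (hR : Avoids G R S W)
    (hRB : R.card + 1 ≤ B) (hS : ∀ s ∈ S, ∀ s' ∈ S, ∀ v, G.Adj s v → G.Adj s' v) :
    CopWins (subdivision G m) (loc G m fun s z f =>
      s ∈ S ∧ f = 1 ∧ (z ∈ W ∨ z ∈ ends R)) := by
  classical
  have hm1 : 1 ≤ m := by omega
  rcases R.eq_empty_or_nonempty with rfl | ⟨e, he⟩
  · refine (h.copWins_empty (by omega) hG 1 fun _ => True).mono (loc_subset ?_)
    rintro s z f hs hf ⟨hsS, rfl, hz⟩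
    exact mem_loc hs hf ⟨hsS, by omega, by omega, trivial,
      hz.imp (fun hz => ⟨hz, Or.inr le_rfl⟩) fun hz => ⟨hz, le_rfl⟩⟩
  have herase := Finset.card_erase_of_mem he
  have hpos : 0 < R.card := Finset.card_pos.2 ⟨e, he⟩
  have hR' : Avoids G (R.erase e) S W := hR.mono (Finset.erase_subset _ _)
  have hsub : ∀ z, z ≠ e.1 → z ≠ e.2 → (z ∈ W ∨ z ∈ ends R) → (z ∈ W ∨ z ∈ ends (R.erase e)) :=
    fun z h1 h2 hz => hz.imp id fun hz => mem_ends_erase hz h1 h2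
  obtain ⟨hab, haS, hbS, haW, hbW⟩ := hR e he
  by_cases hadj : ∀ s ∈ S, G.Adj s e.1 ∧ G.Adj s e.2
  swap
  · push Not at hadj
    obtain ⟨s₀, hs₀, hs₀'⟩ := hadj
    by_cases ha : G.Adj s₀ e.1
    · refine (copWins_probeVertex h hm hG hR' (by omega) haS).mono (loc_subset ?_)
      rintro s z f hs hf ⟨hsS, rfl, hz⟩
      have hzb : z ≠ e.2 := by
        rintro rfl
        exact hs₀' ha (hS s hsS s₀ hs₀ _ hs)
      refine mem_loc hs hf ⟨hsS, by omega, by omega, ?_⟩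
      by_cases hza : z = e.1
      · exact Or.inl hza
      · exact Or.inr ⟨rfl, hsub z hza hzb hz⟩
    · refine (copWins_probeVertex h hm hG hR' (by omega) hbS).mono (loc_subset ?_)
      rintro s z f hs hf ⟨hsS, rfl, hz⟩
      have hza : z ≠ e.1 := by
        rintro rfl
        exact ha (hS s hsS s₀ hs₀ _ hs)
      refine mem_loc hs hf ⟨hsS, by omega, by omega, ?_⟩
      by_cases hzb : z = e.2
      · exact Or.inl hzb
      · exact Or.inr ⟨rfl, hsub z hza hzb hz⟩
  -- With `m - 2 * j` equal to `0` or `3`, the positions with `f = 0` are told from all the others.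
  obtain ⟨j, hj⟩ : ∃ j, 2 * j = m ∨ 2 * j + 3 = m := by
    rcases Nat.even_or_odd' m with ⟨k, hk | hk⟩
    · exact ⟨k, by omega⟩
    · exact ⟨k - 1, by omega⟩
  refine CopWins.probe_loc hm1 (by rintro s z f - ⟨-, rfl, -⟩; omega) (pt G m e.1 e.2 j)
    fun d => ?_
  have key : ∀ s z f, G.Adj s z → f ≤ m → ((∃ g, (s ∈ S ∧ g = 1 ∧
      (z ∈ W ∨ z ∈ ends R)) ∧ g ≤ f + 1 ∧ f ≤ g + 1) ∧
      (subdivision G m).dist (pt G m e.1 e.2 j) (pt G m s z f) = d) →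
      s ∈ S ∧ f ≤ 2 ∧ ((z = e.1 ∧ d = j + (m - f)) ∨
        (z = e.2 ∧ d = min ((m - j) + (m - f)) (m + j + f)) ∨
        (z ≠ e.1 ∧ z ≠ e.2 ∧ (z ∈ W ∨ z ∈ ends (R.erase e)) ∧ d = m + j + f)) := by
    rintro s z f hs hf ⟨⟨g, ⟨hsS, hg, hz⟩, h2, h3⟩, hD⟩
    obtain ⟨hsa, hsb⟩ := hadj s hsS
    refine ⟨hsS, by omega, ?_⟩
    by_cases hza : z = e.1
    · subst hza
      rw [dist_pt_pt_fst hm1 hG hab hs hsb.ne (by omega) hf] at hD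
      exact Or.inl ⟨rfl, hD.symm⟩
    by_cases hzb : z = e.2
    · subst hzb
      rw [dist_pt_pt_snd_of_adj hm1 hG hab hs hsa (by omega) hf] at hD
      exact Or.inr (Or.inl ⟨rfl, hD.symm⟩)
    · rw [dist_pt_pt_of_adj hm1 hG hab hs hsa hsb.ne hza hzb (by omega) (by omega)] at hD
      exact Or.inr (Or.inr ⟨hza, hzb, hsub z hza hzb hz, hD.symm⟩)
  by_cases hd0 : d = m + j
  · refine h.winS.mono (loc_subset ?_)
    intro s z f hs hf hP
    obtain ⟨hsS, hf2, hz⟩ := key s z f hs hf hP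
    exact pt_mem_branch hm1 hs (Or.inl ⟨by omega, hsS⟩)
  by_cases hd : d < m + j
  · refine (copWins_twoEnds (by omega) hG h.winS hab.ne haS (f₁ := m + j - d) (f₂ := m + j - d)
      (by omega)).mono (loc_subset ?_)
    intro s z f hs hf hP
    obtain ⟨hsS, hf2, hz⟩ := key s z f hs hf hP
    refine mem_loc hs hf ⟨hsS, by omega, by omega, ?_⟩
    rcases hz with ⟨hz, hd'⟩ | ⟨hz, hd'⟩ | ⟨-, -, -, hd'⟩
    · exact Or.inl ⟨hz, by omega⟩
    · exact Or.inr ⟨hz, by omega⟩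
    · omega
  by_cases hd1 : d = m + j + 1
  · -- For even `m` the vertex `e.2` is excluded as well; for odd `m` there may be `f = 2`.
    refine (copWins_probeVertex h hm hG hR' (by omega) hbS).mono (loc_subset ?_)
    intro s z f hs hf hP
    obtain ⟨hsS, hf2, hz⟩ := key s z f hs hf hP
    refine mem_loc hs hf ⟨hsS, by omega, by omega, ?_⟩
    rcases hz with ⟨hz, hd'⟩ | ⟨hz, hd'⟩ | ⟨-, -, hz, hd'⟩
    · omega
    · exact Or.inl hz
    · exact Or.inr ⟨by omega, hz⟩
  · refine (copWins_crossing h hm hG (R.erase e) hR' (F := 2) le_rfl (by omega)).mono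
      (loc_subset ?_)
    intro s z f hs hf hP
    obtain ⟨hsS, hf2, hz⟩ := key s z f hs hf hP
    rcases hz with ⟨hz, hd'⟩ | ⟨hz, hd'⟩ | ⟨-, -, hz, hd'⟩
    · omega
    · omega
    · exact mem_loc hs hf ⟨hsS, by omega, by omega, ⟨by omega, by omega⟩,
        hz.imp (fun hz => ⟨hz, Or.inr (by omega)⟩) fun hz => ⟨hz, by omega⟩⟩

end Leaving

/-! ### The strategy on a graph with a small maximal matching -/

section Strategy

variable {V : Type u} {G : SimpleGraph V} {m : ℕ}

/-- The edges of a maximal matching of `G`, each given by an ordered pair of ends, in only one of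
its two orientations. Maximality is encoded by the independence of the unmatched vertices. -/
structure IsMaximalPairing (G : SimpleGraph V) (P : Finset (V × V)) : Prop where
  adj : ∀ e ∈ P, G.Adj e.1 e.2
  disjoint : ∀ e ∈ P, ∀ e' ∈ P, e ≠ e' →
    e.1 ≠ e'.1 ∧ e.1 ≠ e'.2 ∧ e.2 ≠ e'.1 ∧ e.2 ≠ e'.2
  maximal : ∀ v w, v ∉ ends P → w ∉ ends P → ¬ G.Adj v w

/-- The cop wins if she knows that the robber is at an unmatched vertex. As long as some matched
vertex distinguishes the candidates, it is probed; otherwise the candidates have the same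
neighbours. -/
theorem copWins_unmatched [Finite V] {P : Finset (V × V)} (hP : IsMaximalPairing G P)
    (hm : 12 ≤ m) (hPm : P.card + 1 ≤ m) (hG : G.Connected) (S : Set V)
    (hS : ∀ s ∈ S, s ∉ ends P) : CopWins (subdivision G m) (branch G m S) := by
  classical
  have hm1 : 1 ≤ m := by omega
  induction hn : S.ncard using Nat.strong_induction_on generalizing S with
  | _ n ih =>
  have ih' : ∀ T ⊂ S, CopWins (subdivision G m) (branch G m T) := fun T hT =>
    ih T.ncard (hn ▸ Set.ncard_lt_ncard hT) T (fun s hs => hS s (hT.1 hs)) rfl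
  have hav : ∀ T ⊆ S, Avoids G P T T := fun T hT e he =>
    ⟨hP.adj e he, fun h => hS _ (hT h) ⟨e, he, Or.inl rfl⟩,
      fun h => hS _ (hT h) ⟨e, he, Or.inr rfl⟩, fun h => hS _ (hT h) ⟨e, he, Or.inl rfl⟩,
      fun h => hS _ (hT h) ⟨e, he, Or.inr rfl⟩⟩
  have hset : ∀ T ⊂ S, Setting G m T T True m := fun T hT =>
    ⟨ih' T hT, ih' T hT, Or.inl ⟨trivial, rfl, le_rfl⟩⟩
  have hends : ∀ s ∈ S, ∀ z, G.Adj s z → z ∈ ends P := fun s hs z hz => by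
    by_contra hzP
    exact hP.maximal s z (hS s hs) hzP hz
  rcases S.eq_empty_or_nonempty with rfl | ⟨x, hx⟩
  · exact CopWins.branch_of_subsingleton Set.subsingleton_empty
  by_cases hdist : ∃ e ∈ P, ∃ c c', ((c = e.1 ∧ c' = e.2) ∨ (c = e.2 ∧ c' = e.1)) ∧
      ∃ s ∈ S, ∃ s' ∈ S, G.dist c s ≠ G.dist c s'
  · obtain ⟨e, he, c, c', hcc, s₁, hs₁, s₂, hs₂, hne⟩ := hdist
    have herase := Finset.card_erase_of_mem he
    have hpos : 0 < P.card := Finset.card_pos.2 ⟨e, he⟩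
    have hcS : c ∉ S ∧ c' ∉ S := by
      have := hav S subset_rfl e he
      rcases hcc with ⟨rfl, rfl⟩ | ⟨rfl, rfl⟩
      · exact ⟨this.2.1, this.2.2.1⟩
      · exact ⟨this.2.2.1, this.2.1⟩
    have hlevel : ∀ q, {s | s ∈ S ∧ G.dist c s = q} ⊂ S := by
      refine fun q => ⟨fun s hs => hs.1, fun hsub => hne ?_⟩
      rw [(hsub hs₁).2, (hsub hs₂).2]
    refine CopWins.probe_branch hm1 (Sum.inl c) fun d => ?_
    have key : ∀ s z f, G.Adj s z → f ≤ m → ((s ∈ S ∧ f = 1) ∧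
        (subdivision G m).dist (Sum.inl c) (pt G m s z f) = d) →
        s ∈ S ∧ f = 1 ∧ (d % m = 1 ∨ d % m + 1 = m) ∧
        ((d % m = 1 ∧ G.dist c s = d / m) ∨ (d % m + 1 = m ∧ G.dist c s = d / m + 1)) ∧
        (d < m → z = c) ∧ (m ≤ d → z ≠ c) := by
      rintro s z f hs hf ⟨⟨hsS, rfl⟩, hD⟩
      have hcs : c ≠ s := fun h => hcS.1 (h ▸ hsS)
      refine ⟨hsS, rfl, by have := dist_inl_pt_mod hm1 hG hs hf hD; omega, ?_, ?_, ?_⟩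
      · rw [dist_inl_pt hm1 hG c hs hf] at hD
        have h1 := dist_le_dist_add_one hG hs c
        rcases le_or_gt (m * G.dist c s + 1) (m * G.dist c z + (m - 1)) with h2 | h2
        · rw [min_eq_left h2] at hD
          left
          rw [← hD, Nat.mul_add_mod, Nat.mod_eq_of_lt (by omega), Nat.mul_add_div (by omega),
            Nat.div_eq_of_lt (by omega)]
          omega
        · rw [min_eq_right h2.le] at hD
          right
          have h3 : G.dist c z < G.dist c s := by
            by_contra h3
            have := Nat.mul_le_mul_left m (not_lt.1 h3)
            omega
          rw [← hD, Nat.mul_add_mod, Nat.mod_eq_of_lt (by omega), Nat.mul_add_div (by omega),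
            Nat.div_eq_of_lt (by omega)]
          omega
      · intro hd
        by_contra hzc
        have := le_dist_inl_pt hm1 hG hs hf hcs (Ne.symm hzc)
        omega
      · rintro hd rfl
        rw [dist_inl_pt_right hm1 hG hs hf] at hD
        omega
    by_cases hr : d % m = 0
    · refine (ih' _ (hlevel (d / m))).mono (Set.union_subset (branch_mono ?_) (loc_subset ?_))
      · rintro s ⟨hsS, hD⟩
        rw [dist_inl_inl hm1 hG] at hD
        exact ⟨hsS, by rw [← hD, Nat.mul_div_cancel_left _ hm1]⟩
      · intro s z f hs hf hP
        have := (key s z f hs hf hP).2.2.1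
        omega
    -- The result also determines the distance in `G` from `c` to the vertex that the robber left.
    obtain ⟨q, hq⟩ : ∃ q, ∀ s z f, G.Adj s z → f ≤ m → ((s ∈ S ∧ f = 1) ∧
        (subdivision G m).dist (Sum.inl c) (pt G m s z f) = d) → G.dist c s = q := by
      by_cases hr1 : d % m = 1
      · refine ⟨d / m, fun s z f hs hf hP => ?_⟩
        have := (key s z f hs hf hP).2.2.2.1
        omega
      · refine ⟨d / m + 1, fun s z f hs hf hP => ?_⟩
        have := (key s z f hs hf hP).2.2.2.1
        omega
    have hbr : branch G m {s | s ∈ S ∧ (subdivision G m).dist (Sum.inl c) (Sum.inl s) = d} ⊆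
        (∅ : Set (SubdivVertex G m)) := by
      rintro _ ⟨s, ⟨hsS, hD⟩, rfl⟩
      rw [dist_inl_inl hm1 hG] at hD
      exact hr (hD ▸ Nat.mul_mod_right _ _)
    by_cases hd : d < m
    · refine (copWins_knownEnd' (by omega) hG c (ih' _ (hlevel q))).mono
        (Set.union_subset (hbr.trans (Set.empty_subset _)) (loc_subset ?_))
      intro s z f hs hf hP
      obtain ⟨hsS, rfl, -, -, hz, -⟩ := key s z f hs hf hP
      exact mem_loc hs hf ⟨⟨hsS, hq s z _ hs hf hP⟩, hz hd, by omega, by omega⟩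
    · refine (copWins_probeVertex (hset _ (hlevel q)) hm hG
        ((hav _ (hlevel q).1).mono (Finset.erase_subset e P)) (by omega)
        (fun h => hcS.2 h.1)).mono
        (Set.union_subset (hbr.trans (Set.empty_subset _)) (loc_subset ?_))
      intro s z f hs hf hP
      obtain ⟨hsS, rfl, -, -, -, hz⟩ := key s z f hs hf hP
      refine mem_loc hs hf ⟨⟨hsS, hq s z _ hs hf hP⟩, by omega, by omega, ?_⟩
      have hzc := hz (not_lt.1 hd)
      by_cases hzc' : z = c'
      · exact Or.inl hzc'
      · refine Or.inr ⟨rfl, Or.inr (mem_ends_erase (hends s hsS z hs) ?_ ?_)⟩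
        · rcases hcc with ⟨rfl, rfl⟩ | ⟨rfl, rfl⟩ <;> assumption
        · rcases hcc with ⟨rfl, rfl⟩ | ⟨rfl, rfl⟩ <;> assumption
  · -- No matched vertex distinguishes the candidates, and all their neighbours are matched.
    have htwin : ∀ s ∈ S, ∀ s' ∈ S, ∀ v, G.Adj s v → G.Adj s' v := by
      intro s hs s' hs' v hv
      obtain ⟨e, he, hve⟩ := hends s hs v hv
      rw [G.adj_comm, ← SimpleGraph.dist_eq_one_iff_adj] at hv ⊢
      by_contra hne
      refine hdist ⟨e, he, v, if v = e.1 then e.2 else e.1, ?_, s, hs, s', hs', fun h => ?_⟩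
      · split_ifs with h
        · exact Or.inl ⟨h, rfl⟩
        · exact Or.inr ⟨hve.resolve_left h, rfl⟩
      · rw [← h] at hne
        exact hne hv
    have hxP : ∀ T ⊆ S, ∀ s ∈ T, ∀ s' ∈ T, ∀ v, G.Adj s v → G.Adj s' v :=
      fun T hT s hs s' hs' => htwin s (hT hs) s' (hT hs')
    by_cases hsub : S.Subsingleton
    · exact CopWins.branch_of_subsingleton hsub
    have hxS : {x} ⊂ S := by
      refine ⟨Set.singleton_subset_iff.2 hx, fun h => hsub ?_⟩
      exact Set.subsingleton_singleton.anti h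
    have hSx : S \ {x} ⊂ S := ⟨Set.sdiff_subset, fun h => (h hx).2 rfl⟩
    refine CopWins.probe_branch hm1 (Sum.inl x) fun d => ?_
    have key : ∀ s z f, G.Adj s z → f ≤ m → ((s ∈ S ∧ f = 1) ∧
        (subdivision G m).dist (Sum.inl x) (pt G m s z f) = d) →
        s ∈ S ∧ f = 1 ∧ d % m ≠ 0 ∧ (s = x ↔ d = 1) := by
      rintro s z f hs hf ⟨⟨hsS, rfl⟩, hD⟩
      have hmod := dist_inl_pt_mod hm1 hG hs hf hD
      refine ⟨hsS, rfl, by omega, ?_, ?_⟩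
      · rintro rfl
        rw [dist_inl_pt_left hm1 hG hs hf] at hD
        omega
      · intro hd
        by_contra hsx
        have hzx : x ≠ z := fun h => hS x hx (h ▸ hends s hsS z hs)
        have := le_dist_inl_pt hm1 hG hs hf (Ne.symm hsx) hzx
        omega
    by_cases hd0 : d = 0
    · refine (ih' _ hxS).mono (Set.union_subset (branch_mono ?_) (loc_subset ?_))
      · rintro s ⟨hsS, hD⟩
        by_contra hsx
        rw [dist_inl_inl hm1 hG] at hD
        have := le_mul_dist (m := m) hG (fun h : x = s => hsx h.symm)
        omega
      · intro s z f hs hf hP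
        obtain ⟨-, -, h3, -⟩ := key s z f hs hf hP
        exact absurd (hd0 ▸ Nat.zero_mod m) h3
    by_cases hr : d % m = 0
    · refine (ih' _ hSx).mono (Set.union_subset (branch_mono ?_) (loc_subset ?_))
      · rintro s ⟨hsS, hD⟩
        refine ⟨hsS, fun hsx : s = x => hd0 ?_⟩
        rw [hsx, SimpleGraph.dist_self] at hD
        exact hD.symm
      · intro s z f hs hf hP
        exact absurd hr (key s z f hs hf hP).2.2.1
    have hbr : branch G m {s | s ∈ S ∧ (subdivision G m).dist (Sum.inl x) (Sum.inl s) = d} ⊆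
        (∅ : Set (SubdivVertex G m)) := by
      rintro _ ⟨s, ⟨hsS, hD⟩, rfl⟩
      rw [dist_inl_inl hm1 hG] at hD
      exact hr (hD ▸ Nat.mul_mod_right _ _)
    by_cases hd1 : d = 1
    · refine (copWins_twins (hset _ hxS) hm hG (hav _ hxS.1) hPm (hxP _ hxS.1)).mono
        (Set.union_subset (hbr.trans (Set.empty_subset _)) (loc_subset ?_))
      intro s z f hs hf hP
      obtain ⟨hsS, hf1, -, hsx⟩ := key s z f hs hf hP
      exact mem_loc hs hf ⟨hsx.2 hd1, hf1, Or.inr (hends s hsS z hs)⟩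
    · refine (copWins_twins (hset _ hSx) hm hG (hav _ hSx.1) hPm (hxP _ hSx.1)).mono
        (Set.union_subset (hbr.trans (Set.empty_subset _)) (loc_subset ?_))
      intro s z f hs hf hP
      obtain ⟨hsS, hf1, -, hsx⟩ := key s z f hs hf hP
      exact mem_loc hs hf ⟨⟨hsS, fun h => hd1 (hsx.1 h)⟩, hf1, Or.inr (hends s hsS z hs)⟩

/-- One more edge `e` of the matching: a probe near an end of `e` tells whether the robber comes
from that edge. -/
theorem copWins_insert [Finite V] [DecidableEq V] {P : Finset (V × V)}
    (hP : IsMaximalPairing G P) (hm : 12 ≤ m) (hPm : P.card + 1 ≤ m) (hG : G.Connected)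
    {Q : Finset (V × V)} {e : V × V} (hQ : insert e Q ⊆ P) (he : e ∉ Q)
    (hW : CopWins (subdivision G m) (branch G m (ends Q ∪ (ends P)ᶜ))) :
    CopWins (subdivision G m) (branch G m (ends (insert e Q) ∪ (ends P)ᶜ)) := by
  have hm1 : 1 ≤ m := by omega
  have heP : e ∈ P := hQ (Finset.mem_insert_self e Q)
  have hQP : Q ⊆ P := (Finset.subset_insert e Q).trans hQ
  set W : Set V := ends Q ∪ (ends P)ᶜ with hWdef
  set R := P \ insert e Q with hRdef
  have hRcard : R.card + 1 ≤ P.card := by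
    have h1 : R.card + (insert e Q).card = P.card := Finset.card_sdiff_add_card_eq_card hQ
    have h2 := Finset.card_insert_of_notMem he
    omega
  have hxx : G.Adj e.1 e.2 := hP.adj e heP
  have hsW : ∀ s ∈ ends (insert e Q) ∪ (ends P)ᶜ, s ≠ e.1 → s ≠ e.2 → s ∈ W := by
    rintro s (⟨e', he', hs⟩ | hs) h1 h2
    · rcases Finset.mem_insert.1 he' with rfl | he'
      · tauto
      · exact Or.inl ⟨e', he', hs⟩
    · exact Or.inr hs
  have hzWR : ∀ z, z ≠ e.1 → z ≠ e.2 → z ∈ W ∨ z ∈ ends R := by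
    intro z h1 h2
    by_cases hz : z ∈ ends P
    · obtain ⟨e', he', hz⟩ := hz
      by_cases he'Q : e' ∈ Q
      · exact Or.inl (Or.inl ⟨e', he'Q, hz⟩)
      · refine Or.inr ⟨e', Finset.mem_sdiff.2 ⟨he', fun h => ?_⟩, hz⟩
        rcases Finset.mem_insert.1 h with rfl | h
        · tauto
        · exact he'Q h
    · exact Or.inl (Or.inr hz)
  have hnotW : ∀ e' ∈ P, e' ∉ Q → e'.1 ∉ W ∧ e'.2 ∉ W := by
    intro e' he' he'Q
    constructor
    · rintro (⟨q, hq, h⟩ | h)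
      · have := hP.disjoint e' he' q (hQP hq) (fun h => he'Q (h ▸ hq))
        tauto
      · exact h ⟨e', he', Or.inl rfl⟩
    · rintro (⟨q, hq, h⟩ | h)
      · have := hP.disjoint e' he' q (hQP hq) (fun h => he'Q (h ▸ hq))
        tauto
      · exact h ⟨e', he', Or.inr rfl⟩
  have hxW := hnotW e heP he
  have hR : ∀ e' ∈ R, G.Adj e'.1 e'.2 ∧ e'.1 ∉ W ∧ e'.2 ∉ W ∧ e'.1 ≠ e.1 ∧ e'.1 ≠ e.2 ∧
      e'.2 ≠ e.1 ∧ e'.2 ≠ e.2 := by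
    intro e' he'
    obtain ⟨he'P, he'Q⟩ := Finset.mem_sdiff.1 he'
    rw [Finset.mem_insert, not_or] at he'Q
    have := hnotW e' he'P he'Q.2
    have := hP.disjoint e' he'P e heP he'Q.1
    exact ⟨hP.adj e' he'P, by tauto⟩
  -- If the robber has just left a known end of `e`, there is one round less, but also one edge less.
  have hsingle : ∀ x, (∀ e' ∈ R, e'.1 ≠ x ∧ e'.2 ≠ x) → ∀ z₀,
      (∀ z, G.Adj x z → z ≠ z₀ → z ∈ W ∨ z ∈ ends R) →
      CopWins (subdivision G m) (loc G m fun s z f => s = x ∧ f = 1 ∧ z ≠ z₀) := by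
    intro x hx z₀ hz₀
    refine (copWins_twins (S := {x}) (W := W) (t := False) (B := m - 1) (R := R)
      ⟨CopWins.branch_of_subsingleton Set.subsingleton_singleton, hW,
        Or.inr ⟨id, ⟨x, rfl⟩, by omega⟩⟩ hm hG ?_ (by omega) ?_).mono (loc_subset ?_)
    · intro e' he'
      obtain ⟨h1, h2, h3, -⟩ := hR e' he'
      exact ⟨h1, (hx e' he').1, (hx e' he').2, h2, h3⟩
    · rintro s rfl s' rfl v hv
      exact hv
    · rintro s z f hs hf ⟨rfl, hf1, hz⟩
      exact mem_loc hs hf ⟨rfl, hf1, hz₀ z hs hz⟩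
  refine CopWins.probe_branch hm1 (pt G m e.1 e.2 2) fun d => ?_
  have keyB : ∀ s, (s ∈ ends (insert e Q) ∪ (ends P)ᶜ ∧
      (subdivision G m).dist (pt G m e.1 e.2 2) (Sum.inl s) = d) →
      (s = e.1 ∧ d = 2) ∨ (s = e.2 ∧ d = m - 2) ∨
      (s ∈ W ∧ m + 2 ≤ d ∧ (d % m = 2 ∨ d % m + 2 = m)) := by
    rintro s ⟨hsS, hD⟩
    rw [SimpleGraph.dist_comm] at hD
    by_cases h1 : s = e.1
    · subst h1
      rw [dist_inl_pt_left hm1 hG hxx (by omega)] at hD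
      exact Or.inl ⟨rfl, hD.symm⟩
    by_cases h2 : s = e.2
    · subst h2
      rw [dist_inl_pt_right hm1 hG hxx (by omega)] at hD
      exact Or.inr (Or.inl ⟨rfl, hD.symm⟩)
    · have hmod := dist_inl_pt_mod hm1 hG hxx (by omega) hD
      have hle := le_dist_inl_pt hm1 hG hxx (f := 2) (by omega) h1 h2
      exact Or.inr (Or.inr ⟨hsW s hsS h1 h2, by omega, hmod.1⟩)
  -- The results are all different where they need to be, since the probe is at distance `2` from
  -- an end of `e` and the robber at distance `1` from the vertex that he left, and `12 ≤ m`.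
  have keyL : ∀ s z f, G.Adj s z → f ≤ m → ((s ∈ ends (insert e Q) ∪ (ends P)ᶜ ∧ f = 1) ∧
      (subdivision G m).dist (pt G m e.1 e.2 2) (pt G m s z f) = d) →
      f = 1 ∧ ((s = e.1 ∧ z = e.2 ∧ d = 1) ∨ (s = e.2 ∧ z = e.1 ∧ d + 3 = m) ∨
        (s = e.1 ∧ z ≠ e.2 ∧ d = 3) ∨ (s = e.2 ∧ z ≠ e.1 ∧ d + 1 = m) ∨
        (s ∈ W ∧ z = e.1 ∧ d = m + 1) ∨
        (s ∈ W ∧ z ≠ e.1 ∧ m + 3 ≤ d ∧ d % m ≠ 2 ∧ d % m + 2 ≠ m)) := by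
    rintro s z f hs hf ⟨⟨hsS, rfl⟩, hD⟩
    refine ⟨rfl, ?_⟩
    by_cases h1 : s = e.1
    · subst h1
      by_cases h2 : z = e.2
      · subst h2
        rw [dist_pt_pt_same hm1 hG hs (by omega) (by omega)] at hD
        exact Or.inl ⟨rfl, rfl, by omega⟩
      · rw [pt_comm hs hf, dist_pt_pt_fst hm1 hG hxx hs.symm h2 (by omega) (by omega)] at hD
        exact Or.inr (Or.inr (Or.inl ⟨rfl, h2, by omega⟩))
    by_cases h2 : s = e.2
    · subst h2
      by_cases h3 : z = e.1
      · subst h3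
        rw [pt_comm hs hf, dist_pt_pt_same hm1 hG hxx (by omega) (by omega)] at hD
        exact Or.inr (Or.inl ⟨rfl, rfl, by omega⟩)
      · rw [pt_comm hs hf] at hD
        have := dist_pt_pt_snd hm1 hG hxx hs.symm h3 (j := 2) (f := m - 1) (by omega) (by omega)
        exact Or.inr (Or.inr (Or.inr (Or.inl ⟨rfl, h3, by omega⟩)))
    have hs' := hsW s hsS h1 h2
    by_cases h3 : z = e.1
    · subst h3
      rw [dist_pt_pt_fst hm1 hG hxx hs h2 (by omega) hf] at hD
      exact Or.inr (Or.inr (Or.inr (Or.inr (Or.inl ⟨hs', rfl, by omega⟩))))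
    refine Or.inr (Or.inr (Or.inr (Or.inr (Or.inr ⟨hs', h3, ?_⟩))))
    obtain ⟨w, hw, hw'⟩ := dist_pt_pt_mod hm1 hG hxx hs h1 h2 (by omega) hf hD
    refine ⟨?_, by omega, by omega⟩
    by_cases h4 : z = e.2
    · subst h4
      have := dist_pt_pt_snd hm1 hG hxx hs h1 (j := 2) (by omega) hf
      omega
    · have := le_dist_pt_pt hm1 hG hxx hs h1 h2 h3 h4 (j := 2) (by omega) hf
      omega
  have hlocal : ∀ a b, (∀ s z f, G.Adj s z → f ≤ m →
        ((s ∈ ends (insert e Q) ∪ (ends P)ᶜ ∧ f = 1) ∧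
        (subdivision G m).dist (pt G m e.1 e.2 2) (pt G m s z f) = d) → s = a ∧ z = b) →
      d ≠ 2 → d ≠ m - 2 → d < m →
      CopWins (subdivision G m) (branch G m {s | s ∈ ends (insert e Q) ∪ (ends P)ᶜ ∧
        (subdivision G m).dist (pt G m e.1 e.2 2) (Sum.inl s) = d} ∪
        loc G m fun s z f => (s ∈ ends (insert e Q) ∪ (ends P)ᶜ ∧ f = 1) ∧
          (subdivision G m).dist (pt G m e.1 e.2 2) (pt G m s z f) = d) := by
    intro a b hab h1 h2 h3
    refine CopWins.of_subsingleton (Set.Subsingleton.anti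
      (Set.subsingleton_singleton (a := pt G m a b 1)) (Set.union_subset ?_ (loc_subset ?_)))
    · rintro _ ⟨s, hs, rfl⟩
      have := keyB s hs
      omega
    · intro s z f hs hf hP
      obtain ⟨rfl, rfl⟩ := hab s z f hs hf hP
      obtain ⟨⟨-, rfl⟩, -⟩ := hP
      rfl
  by_cases hd1 : d = 1
  · refine hlocal e.1 e.2 (fun s z f hs hf hP => ?_) (by omega) (by omega) (by omega)
    obtain ⟨-, h | h | h | h | h | h⟩ := keyL s z f hs hf hP
    · exact ⟨h.1, h.2.1⟩
    all_goals omega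
  by_cases hd3 : d + 3 = m
  · refine hlocal e.2 e.1 (fun s z f hs hf hP => ?_) (by omega) (by omega) (by omega)
    obtain ⟨-, h | h | h | h | h | h⟩ := keyL s z f hs hf hP
    · omega
    · exact ⟨h.1, h.2.1⟩
    all_goals omega
  by_cases hd2 : d = 2 ∨ d + 2 = m
  · refine (CopWins.branch_of_subsingleton (Set.subsingleton_singleton
      (a := if d = 2 then e.1 else e.2))).mono
      (Set.union_subset (branch_mono ?_) (loc_subset ?_))
    · intro s hs
      rcases keyB s hs with ⟨rfl, h⟩ | ⟨rfl, h⟩ | h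
      · rw [if_pos h]
        rfl
      · rw [if_neg (by omega)]
        rfl
      · omega
    · intro s z f hs hf hP
      have := keyL s z f hs hf hP
      omega
  have hbr : d < m + 2 → branch G m {s | s ∈ ends (insert e Q) ∪ (ends P)ᶜ ∧
        (subdivision G m).dist (pt G m e.1 e.2 2) (Sum.inl s) = d} ⊆
        (∅ : Set (SubdivVertex G m)) := by
    rintro hd _ ⟨s, hs, rfl⟩
    have := keyB s hs
    omega
  by_cases hd4 : d = 3
  · refine (hsingle e.1 (fun e' he' => ⟨(hR e' he').2.2.2.1, (hR e' he').2.2.2.2.2.1⟩) e.2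
      (fun z hz hz2 => hzWR z hz.ne.symm hz2)).mono
      (Set.union_subset ((hbr (by omega)).trans (Set.empty_subset _)) (loc_subset ?_))
    intro s z f hs hf hP
    obtain ⟨hf1, h | h | h | h | h | h⟩ := keyL s z f hs hf hP
    · omega
    · omega
    · exact mem_loc hs hf ⟨h.1, hf1, h.2.1⟩
    all_goals omega
  by_cases hd5 : d + 1 = m
  · refine (hsingle e.2 (fun e' he' => ⟨(hR e' he').2.2.2.2.1, (hR e' he').2.2.2.2.2.2⟩) e.1
      (fun z hz hz1 => hzWR z hz1 hz.ne.symm)).mono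
      (Set.union_subset ((hbr (by omega)).trans (Set.empty_subset _)) (loc_subset ?_))
    intro s z f hs hf hP
    obtain ⟨hf1, h | h | h | h | h | h⟩ := keyL s z f hs hf hP
    · omega
    · omega
    · omega
    · exact mem_loc hs hf ⟨h.1, hf1, h.2.1⟩
    all_goals omega
  by_cases hd6 : d = m + 1
  · refine (copWins_knownEnd' (by omega) hG e.1 hW).mono
      (Set.union_subset ((hbr (by omega)).trans (Set.empty_subset _)) (loc_subset ?_))
    intro s z f hs hf hP
    obtain ⟨hf1, h | h | h | h | h | h⟩ := keyL s z f hs hf hP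
    · omega
    · omega
    · omega
    · omega
    · exact mem_loc hs hf ⟨h.1, h.2.1, by omega, by omega⟩
    · omega
  by_cases hr : d % m = 2 ∨ d % m + 2 = m
  · refine hW.mono (Set.union_subset (branch_mono ?_) (loc_subset ?_))
    · intro s hs
      rcases keyB s hs with h | h | h
      · omega
      · omega
      · exact h.1
    · intro s z f hs hf hP
      have := keyL s z f hs hf hP
      omega
  · refine (copWins_probeVertex (R := R) (v := e.2) (t := True) (B := m)
      ⟨hW, hW, Or.inl ⟨trivial, rfl, le_rfl⟩⟩ hm hG
      (fun e' he' => ⟨(hR e' he').1, (hR e' he').2.1, (hR e' he').2.2.1, (hR e' he').2.1,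
        (hR e' he').2.2.1⟩) (by omega) hxW.2).mono
      (Set.union_subset ?_ (loc_subset ?_))
    · rintro _ ⟨s, hs, rfl⟩
      have := keyB s hs
      omega
    · intro s z f hs hf hP
      obtain ⟨rfl, h | h | h | h | h | h⟩ := keyL s z f hs hf hP
      · omega
      · omega
      · omega
      · omega
      · omega
      · refine mem_loc hs hf ⟨h.1, by omega, by omega, ?_⟩
        by_cases hz : z = e.2
        · exact Or.inl hz
        · exact Or.inr ⟨rfl, hzWR z h.2.1 hz⟩

theorem IsMaximalPairing.locatable [Finite V] {P : Finset (V × V)} (hP : IsMaximalPairing G P)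
    (hm : 12 ≤ m) (hPm : P.card + 1 ≤ m) (hG : G.Connected) : Locatable (subdivision G m) := by
  classical
  have hm1 : 1 ≤ m := by omega
  have hall : ∀ Q ⊆ P, CopWins (subdivision G m) (branch G m (ends Q ∪ (ends P)ᶜ)) := by
    intro Q
    induction Q using Finset.induction_on with
    | empty =>
      intro _
      refine copWins_unmatched hP hm hPm hG _ fun s hs => ?_
      rw [ends_empty, Set.empty_union] at hs
      exact hs
    | insert e Q he ih =>
      exact fun hQ => copWins_insert hP hm hPm hG hQ he
        (ih ((Finset.subset_insert e Q).trans hQ))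
  have huniv := hall P subset_rfl
  rw [Set.union_compl_self] at huniv
  obtain ⟨N, hN⟩ := copWins_univ (by omega) hG huniv
  obtain ⟨v⟩ := hG.nonempty
  have : Nonempty (SubdivVertex G m) := ⟨Sum.inl v⟩
  exact locatable_of_winsIn hN

end Strategy

/-! ### Maximal matchings -/

section Matching

variable {V : Type u} {G : SimpleGraph V}

/-- By maximality the unmatched vertices are independent: an edge between two of them could be
added to the matching. -/
theorem IsMaximalMatching.exists_isMaximalPairing [Finite V] {M : G.Subgraph}
    (hM : IsMaximalMatching M) :
    ∃ P : Finset (V × V), IsMaximalPairing G P ∧ P.card = M.edgeSet.ncard := by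
  classical
  have hmatch : M.IsMatching := hM.prop
  have hout : ∀ q : Sym2 V, s((Quot.out q).1, (Quot.out q).2) = q := fun q => Quot.out_eq q
  have hinj : Function.Injective (fun q : Sym2 V => Quot.out q) := fun q q' h => by
    rw [← hout q, ← hout q']
    exact congrArg (fun x : V × V => s(x.1, x.2)) h
  have hfin := M.edgeSet.toFinite
  refine ⟨hfin.toFinset.image fun q => Quot.out q, ⟨?_, ?_, ?_⟩, ?_⟩
  · intro e he
    obtain ⟨q, hq, rfl⟩ := Finset.mem_image.1 he
    have h : s((Quot.out q).1, (Quot.out q).2) ∈ M.edgeSet := by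
      rw [hout]
      exact hfin.mem_toFinset.1 hq
    exact M.adj_sub h
  · intro e he e' he' hne
    obtain ⟨q, hq, rfl⟩ := Finset.mem_image.1 he
    obtain ⟨q', hq', rfl⟩ := Finset.mem_image.1 he'
    have h : M.Adj (Quot.out q).1 (Quot.out q).2 := by
      have h := hfin.mem_toFinset.1 hq
      rwa [← hout q] at h
    have h' : M.Adj (Quot.out q').1 (Quot.out q').2 := by
      have h := hfin.mem_toFinset.1 hq'
      rwa [← hout q'] at h
    have hqq : s((Quot.out q).1, (Quot.out q).2) ≠ s((Quot.out q').1, (Quot.out q').2) := by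
      rw [hout, hout]
      rintro rfl
      exact hne rfl
    refine ⟨fun h1 => hqq ?_, fun h1 => hqq ?_, fun h1 => hqq ?_, fun h1 => hqq ?_⟩
    · rw [h1] at h ⊢
      rw [hmatch.eq_of_adj_left h h']
    · rw [h1] at h ⊢
      rw [hmatch.eq_of_adj_left h h'.symm, Sym2.eq_swap]
    · rw [h1] at h ⊢
      rw [hmatch.eq_of_adj_right h h'.symm, Sym2.eq_swap]
    · rw [h1] at h ⊢
      rw [hmatch.eq_of_adj_right h h']
  · have hverts : ∀ v, v ∉ ends (hfin.toFinset.image fun q => Quot.out q) → v ∉ M.verts := by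
      intro v hv hvM
      obtain ⟨w, hw, -⟩ := hmatch hvM
      refine hv ⟨Quot.out s(v, w),
        Finset.mem_image_of_mem _ (hfin.mem_toFinset.2 hw), ?_⟩
      have h : v ∈ s((Quot.out s(v, w)).1, (Quot.out s(v, w)).2) := by
        rw [hout]
        exact Sym2.mem_mk_left v w
      exact Sym2.mem_iff.1 h
    intro v w hv hw hadj
    have hM' : (M ⊔ G.subgraphOfAdj hadj).IsMatching := by
      refine hmatch.sup (SimpleGraph.Subgraph.IsMatching.subgraphOfAdj hadj) ?_
      rw [Set.disjoint_left]
      intro x hx hx'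
      have hxM := M.support_subset_verts hx
      have hx2 := (G.subgraphOfAdj hadj).support_subset_verts hx'
      rw [SimpleGraph.subgraphOfAdj_verts] at hx2
      rcases hx2 with rfl | rfl
      · exact hverts _ hv hxM
      · exact hverts _ hw hxM
    refine hverts v hv ((hM.le_of_ge hM' le_sup_left).1 ?_)
    rw [SimpleGraph.Subgraph.verts_sup, SimpleGraph.subgraphOfAdj_verts]
    exact Or.inr (Or.inl rfl)
  · rw [Finset.card_image_of_injective _ hinj, Set.ncard_eq_toFinset_card _ hfin]

/-- The edges `{0, 1}, {2, 3}, …, {2 * k - 2, 2 * k - 1}` of the complete graph on `2 * k + 1`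
vertices. -/
def consecutivePairs (k : ℕ) : (⊤ : SimpleGraph (Fin (2 * k + 1))).Subgraph where
  verts := {x | x.val < 2 * k}
  Adj x y := x ≠ y ∧ x.val / 2 = y.val / 2
  adj_sub h := h.1
  edge_vert := by
    rintro x y ⟨h1, h2⟩
    have h3 := Fin.val_ne_of_ne h1
    have h4 := x.isLt
    have h5 := y.isLt
    change x.val < 2 * k
    omega
  symm := ⟨fun _ _ h => ⟨h.1.symm, h.2.symm⟩⟩

theorem isMatching_consecutivePairs (k : ℕ) : (consecutivePairs k).IsMatching := by
  intro x hx
  change x.val < 2 * k at hx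
  refine ⟨⟨if x.val % 2 = 0 then x.val + 1 else x.val - 1, by split_ifs <;> omega⟩,
    ⟨fun h => ?_, ?_⟩, ?_⟩
  · have h' : x.val = if x.val % 2 = 0 then x.val + 1 else x.val - 1 := congrArg Fin.val h
    split_ifs at h' <;> omega
  · change x.val / 2 = (if x.val % 2 = 0 then x.val + 1 else x.val - 1) / 2
    split_ifs <;> omega
  · rintro y ⟨h1, h2⟩
    have h3 := Fin.val_ne_of_ne h1
    refine Fin.ext ?_
    change y.val = if x.val % 2 = 0 then x.val + 1 else x.val - 1
    split_ifs <;> omega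

/-- Only one vertex is unmatched, so no edge can be added. -/
theorem isMaximalMatching_consecutivePairs (k : ℕ) :
    IsMaximalMatching (consecutivePairs k) := by
  refine ⟨isMatching_consecutivePairs k, fun M' hM' hle => ?_⟩
  have hverts : M'.verts ⊆ (consecutivePairs k).verts := by
    intro x hx
    change x.val < 2 * k
    by_contra hxk
    obtain ⟨w, hw, -⟩ := hM' hx
    have hne := Fin.val_ne_of_ne hw.ne
    have hwk : w ∈ (consecutivePairs k).verts := by
      change w.val < 2 * k
      omega
    obtain ⟨w', hw', -⟩ := isMatching_consecutivePairs k hwk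
    have hw'x := hM'.eq_of_adj_left (hle.2 hw') hw.symm
    have h : w'.val < 2 * k := hw'.snd_mem
    rw [hw'x] at h
    exact hxk h
  refine ⟨hverts, fun x y hxy => ?_⟩
  obtain ⟨y', hy', -⟩ := isMatching_consecutivePairs k (hverts hxy.fst_mem)
  rwa [hM'.eq_of_adj_left hxy (hle.2 hy')]

theorem ncard_edgeSet_consecutivePairs (k : ℕ) : (consecutivePairs k).edgeSet.ncard = k := by
  let f : Fin k → Sym2 (Fin (2 * k + 1)) := fun i =>
    s(⟨2 * i.val, by omega⟩, ⟨2 * i.val + 1, by omega⟩)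
  have hf : Function.Injective f := by
    intro i j h
    refine Fin.ext ?_
    rcases Sym2.eq_iff.1 h with ⟨h, -⟩ | ⟨h, -⟩
    · have := congrArg Fin.val h
      dsimp only at this
      omega
    · have := congrArg Fin.val h
      dsimp only at this
      omega
  have hrange : (consecutivePairs k).edgeSet = Set.range f := by
    ext q
    induction q using Sym2.ind with
    | _ x y =>
    rw [SimpleGraph.Subgraph.mem_edgeSet]
    constructor
    · intro hxy
      have hx : x.val < 2 * k := hxy.fst_mem
      obtain ⟨h1, h2⟩ := hxy
      have h3 := Fin.val_ne_of_ne h1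
      refine ⟨⟨x.val / 2, by omega⟩, Sym2.eq_iff.2 ?_⟩
      rcases Nat.even_or_odd' x.val with ⟨c, hc | hc⟩
      · exact Or.inl ⟨Fin.ext (show 2 * (x.val / 2) = x.val by omega),
          Fin.ext (show 2 * (x.val / 2) + 1 = y.val by omega)⟩
      · exact Or.inr ⟨Fin.ext (show 2 * (x.val / 2) = y.val by omega),
          Fin.ext (show 2 * (x.val / 2) + 1 = x.val by omega)⟩
    · rintro ⟨i, hi⟩
      have hadj : (consecutivePairs k).Adj ⟨2 * i.val, by omega⟩ ⟨2 * i.val + 1, by omega⟩ :=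
        ⟨Fin.ne_of_val_ne (show 2 * i.val ≠ 2 * i.val + 1 by omega),
          show 2 * i.val / 2 = (2 * i.val + 1) / 2 by omega⟩
      rcases Sym2.eq_iff.1 hi with ⟨rfl, rfl⟩ | ⟨rfl, rfl⟩
      · exact hadj
      · exact hadj.symm
  rw [hrange, Set.ncard_range_of_injective hf, Nat.card_eq_fintype_card, Fintype.card_fin]

end Matching

/-! ### Subdivided complete graphs that are not locatable -/

section Complete

variable {V : Type u} {k : ℕ}

theorem pt_mem_update {G : SimpleGraph V} (hk : 1 ≤ k) {S : Set (SubdivVertex G k)} {s z : V}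
    (h : G.Adj s z) {f f' d : ℕ} (hS : pt G k s z f ∈ S) (h1 : f ≤ f' + 1) (h2 : f' ≤ f + 1)
    (hf : f ≤ k) (hf' : f' ≤ k) {p : SubdivVertex G k}
    (hd : (subdivision G k).dist p (pt G k s z f') = d) :
    pt G k s z f' ∈ update (subdivision G k) S p d := by
  refine ⟨⟨_, hS, ?_⟩, hd⟩
  rcases lt_trichotomy f f' with h3 | rfl | h3
  · obtain rfl : f' = f + 1 := by omega
    exact Or.inr (subdivision_adj_pt hk h hf')
  · exact Or.inl rfl
  · obtain rfl : f = f' + 1 := by omega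
    exact Or.inr (subdivision_adj_pt hk h hf).symm

/-- In a subdivided complete graph, all threads not met by the probed one look the same, and the
result does not tell the two halves of such a thread apart. -/
theorem dist_top_of_disjoint [Nonempty V] (hk : 1 ≤ k) {a b s z : V} (hab : a ≠ b) (hsz : s ≠ z)
    (hsa : s ≠ a) (hsb : s ≠ b) (hza : z ≠ a) (hzb : z ≠ b) {j f : ℕ} (hj : j ≤ k) (hf : f ≤ k) :
    (subdivision (⊤ : SimpleGraph V) k).dist (pt ⊤ k a b j) (pt ⊤ k s z f) =
      k + min j (k - j) + min f (k - f) := by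
  rw [dist_pt_pt hk SimpleGraph.connected_top hab hsz (edge_ne_of_left hsa hsb) hj hf,
    SimpleGraph.dist_top_of_ne hsa.symm, SimpleGraph.dist_top_of_ne hza.symm,
    SimpleGraph.dist_top_of_ne hsb.symm, SimpleGraph.dist_top_of_ne hzb.symm]
  omega

/-- In a subdivided complete graph, all threads that meet the probed one in the same vertex look
the same. -/
theorem dist_top_of_common [Nonempty V] (hk : 1 ≤ k) {s b z : V} (hsb : s ≠ b) (hsz : s ≠ z)
    (hzb : z ≠ b) {j f : ℕ} (hj : j ≤ k) (hf : f ≤ k) :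
    (subdivision (⊤ : SimpleGraph V) k).dist (pt ⊤ k s b j) (pt ⊤ k s z f) =
      min (min (j + f) (j + k + (k - f))) (min (k - j + k + f) (k - j + k + (k - f))) := by
  rw [dist_pt_pt hk SimpleGraph.connected_top hsb hsz
    (fun h => by rcases Sym2.eq_iff.1 h with h | h <;> tauto) hj hf,
    SimpleGraph.dist_self, SimpleGraph.dist_top_of_ne hsz,
    SimpleGraph.dist_top_of_ne hsb.symm, SimpleGraph.dist_top_of_ne hzb.symm]
  omega

/-- If the robber may be at two different vertices of the original graph, he escapes: unless the
first probe is on a thread at one of these, he stays; otherwise he leaves that vertex `u`, on a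
thread that is not yet met by any probed thread. There remains more than one such thread `uz` till
he arrives at `z`, if all the probes but the first meet two new threads; and in the exceptional
case, he may as well have turned back to `u` halfway. -/
theorem not_winsIn_top [Fintype V] (hV : Fintype.card V = 2 * k + 1) (hk : 2 ≤ k) (n : ℕ) :
    (∀ (S : Set (SubdivVertex (⊤ : SimpleGraph V) k)) (u v : V), u ≠ v → Sum.inl u ∈ S →
      Sum.inl v ∈ S → ¬ WinsIn (subdivision ⊤ k) n S) ∧
    (∀ (S : Set (SubdivVertex (⊤ : SimpleGraph V) k)) (u : V) (W : Finset V) (t : ℕ), 1 ≤ t →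
      t ≤ k → u ∈ W → W.card ≤ 2 * t → (∀ z ∉ W, pt ⊤ k u z t ∈ S) →
      (W.card + 1 ≤ 2 * t ∨ ∀ z ∉ W, pt ⊤ k u z (min t (k - t)) ∈ S) →
      ¬ WinsIn (subdivision ⊤ k) n S) := by
  classical
  have hk1 : 1 ≤ k := by omega
  have : Nonempty V := Fintype.card_pos_iff.1 (by omega)
  have htwo : ∀ W : Finset V, W.card + 1 ≤ 2 * k → ∃ z ∉ W, ∃ z' ∉ W, z ≠ z' := by
    intro W hW
    obtain ⟨z, hz, z', hz', hne⟩ := Finset.one_lt_card.1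
      (show 1 < Wᶜ.card by rw [Finset.card_compl]; omega)
    exact ⟨z, Finset.mem_compl.1 hz, z', Finset.mem_compl.1 hz', hne⟩
  have hprobe : ∀ p : SubdivVertex (⊤ : SimpleGraph V) k, ∃ a b j, a ≠ b ∧ j ≤ k ∧
      p = pt ⊤ k a b j := by
    intro p
    rcases exists_eq_pt hk1 p with ⟨a, rfl⟩ | ⟨a, b, j, hab, h0, h1, rfl⟩
    · obtain ⟨b, hb, -⟩ := htwo {a} (by rw [Finset.card_singleton]; omega)
      rw [Finset.mem_singleton] at hb
      exact ⟨a, b, 0, Ne.symm hb, by omega, (pt_zero hk1 a b).symm⟩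
    · exact ⟨a, b, j, hab, h1.le, rfl⟩
  -- The ends of the original edges can be swapped, so a vertex on the probed thread comes first.
  have hswap : ∀ (a b : V) (j : ℕ), a ≠ b → j ≤ k → ∀ u, u = a ∨ u = b →
      ∃ b' j', u ≠ b' ∧ j' ≤ k ∧ pt (⊤ : SimpleGraph V) k a b j = pt ⊤ k u b' j' := by
    rintro a b j hab hj u (rfl | rfl)
    · exact ⟨b, j, hab, hj, rfl⟩
    · exact ⟨a, k - j, hab.symm, Nat.sub_le k j, pt_comm hab hj⟩
  have hA0 : ∀ (S : Set (SubdivVertex (⊤ : SimpleGraph V) k)) (u v : V), u ≠ v → Sum.inl u ∈ S →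
      Sum.inl v ∈ S → ¬ S.Subsingleton := fun S u v huv hu hv h => huv (Sum.inl.inj (h hu hv))
  have hB0 : ∀ (S : Set (SubdivVertex (⊤ : SimpleGraph V) k)) (u : V) (W : Finset V) (t : ℕ),
      1 ≤ t → t < k → u ∈ W → W.card ≤ 2 * t → (∀ z ∉ W, pt ⊤ k u z t ∈ S) →
      ¬ S.Subsingleton := by
    intro S u W t ht1 htk hu hW hS hsub
    obtain ⟨z, hz, z', hz', hne⟩ := htwo W (by omega)
    have huz : u ≠ z := fun h => hz (h ▸ hu)
    have huz' : u ≠ z' := fun h => hz' (h ▸ hu)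
    rcases pt_inj hk1 huz huz' (by omega) htk htk.le (hsub (hS z hz) (hS z' hz')) with h | h
    · exact hne h.2.1.symm
    · exact huz h.1
  -- At `t = k` the robber has arrived.
  have hend : ∀ n, (∀ (S : Set (SubdivVertex (⊤ : SimpleGraph V) k)) (u v : V), u ≠ v →
      Sum.inl u ∈ S → Sum.inl v ∈ S → ¬ WinsIn (subdivision ⊤ k) n S) →
      ∀ (S : Set (SubdivVertex (⊤ : SimpleGraph V) k)) (u : V) (W : Finset V), u ∈ W →
      W.card ≤ 2 * k → (∀ z ∉ W, pt ⊤ k u z k ∈ S) →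
      (W.card + 1 ≤ 2 * k ∨ ∀ z ∉ W, pt ⊤ k u z (min k (k - k)) ∈ S) →
      ¬ WinsIn (subdivision ⊤ k) n S := by
    intro n hn S u W hu hW hS hret
    have hS' : ∀ z ∉ W, Sum.inl z ∈ S := fun z hz => by
      rw [← pt_self hk1 (show (⊤ : SimpleGraph V).Adj u z from fun h => hz (h ▸ hu))]
      exact hS z hz
    rcases hret with hret | hret
    · obtain ⟨z, hz, z', hz', hne⟩ := htwo W hret
      exact hn S z z' hne (hS' z hz) (hS' z' hz')
    · obtain ⟨z, -, hz⟩ := Finset.exists_mem_notMem_of_card_lt_card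
        (show W.card < (Finset.univ : Finset V).card by rw [Finset.card_univ]; omega)
      refine hn S u z (fun h => hz (h ▸ hu)) ?_ (hS' z hz)
      have := hret z hz
      rwa [Nat.sub_self, Nat.min_zero, pt_zero hk1] at this
  induction n with
  | zero =>
    refine ⟨hA0, fun S u W t ht1 htk hu hW hS hret => ?_⟩
    rcases htk.lt_or_eq with htk | rfl
    · exact hB0 S u W t ht1 htk hu hW hS
    · exact hend 0 hA0 S u W hu hW hS hret
  | succ n ih =>
    obtain ⟨ihA, ihB⟩ := ih
    have hleave : ∀ (S : Set (SubdivVertex (⊤ : SimpleGraph V) k)) (u b : V) (j : ℕ), u ≠ b →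
        j ≤ k → Sum.inl u ∈ S →
        ∃ d, ¬ WinsIn (subdivision ⊤ k) n (update (subdivision ⊤ k) S (pt ⊤ k u b j) d) := by
      intro S u b j hub hj hu
      refine ⟨min (min (j + 1) (j + k + (k - 1))) (min (k - j + k + 1) (k - j + k + (k - 1))),
        ihB _ u {u, b} 1 le_rfl hk1 (Finset.mem_insert_self _ _) Finset.card_le_two
        (fun z hz => ?_) (Or.inr fun z hz => ?_)⟩
      all_goals
        rw [Finset.mem_insert, Finset.mem_singleton, not_or] at hz
        rw [← pt_zero hk1 u z] at hu
      · exact pt_mem_update hk1 (Ne.symm hz.1) hu (by omega) (by omega) (by omega) hk1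
          (dist_top_of_common hk1 hub (Ne.symm hz.1) hz.2 hj hk1)
      · rw [min_eq_left (show 1 ≤ k - 1 by omega)]
        exact pt_mem_update hk1 (Ne.symm hz.1) hu (by omega) (by omega) (by omega) hk1
          (dist_top_of_common hk1 hub (Ne.symm hz.1) hz.2 hj hk1)
    -- Away from `u` and `v`, a probe does not tell these two vertices apart.
    have hA : ∀ (S : Set (SubdivVertex (⊤ : SimpleGraph V) k)) (u v : V), u ≠ v →
        Sum.inl u ∈ S → Sum.inl v ∈ S → ¬ WinsIn (subdivision ⊤ k) (n + 1) S := by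
      rintro S u v huv hu hv (hsub | ⟨p, hp⟩)
      · exact hA0 S u v huv hu hv hsub
      obtain ⟨a, b, j, hab, hj, rfl⟩ := hprobe p
      by_cases hua : u = a ∨ u = b
      · obtain ⟨b', j', hub, hj', h⟩ := hswap a b j hab hj u hua
        obtain ⟨d, hd⟩ := hleave S u b' j' hub hj' hu
        exact hd (h ▸ hp d)
      by_cases hva : v = a ∨ v = b
      · obtain ⟨b', j', hvb, hj', h⟩ := hswap a b j hab hj v hva
        obtain ⟨d, hd⟩ := hleave S v b' j' hvb hj' hv
        exact hd (h ▸ hp d)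
      rw [not_or] at hua hva
      refine ihA _ u v huv ?_ ?_ (hp (k + min j (k - j) + min 0 (k - 0)))
      · rw [← pt_zero hk1 u v] at hu ⊢
        exact pt_mem_update hk1 huv hu (by omega) (by omega) (by omega) (by omega)
          (dist_top_of_disjoint hk1 hab huv hua.1 hua.2 hva.1 hva.2 hj (by omega))
      · rw [← pt_zero hk1 v u] at hv ⊢
        exact pt_mem_update hk1 huv.symm hv (by omega) (by omega) (by omega) (by omega)
          (dist_top_of_disjoint hk1 hab huv.symm hva.1 hva.2 hua.1 hua.2 hj (by omega))
    refine ⟨hA, fun S u W t ht1 htk hu hW hS hret => ?_⟩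
    rcases htk.lt_or_eq with htk | rfl
    swap
    · exact hend (n + 1) hA S u W hu hW hS hret
    rintro (hsub | ⟨p, hp⟩)
    · exact hB0 S u W t ht1 htk hu hW hS hsub
    obtain ⟨a, b, j, hab, hj, rfl⟩ := hprobe p
    by_cases hua : u = a ∨ u = b
    · obtain ⟨b', j', hub, hj', h⟩ := hswap a b j hab hj u hua
      rw [h] at hp
      have hcard := Finset.card_insert_le b' W
      refine ihB _ u (insert b' W) (t + 1) (by omega) htk (Finset.mem_insert_of_mem hu) (by omega)
        (fun z hz => ?_) (Or.inl (by omega))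
        (hp (min (min (j' + (t + 1)) (j' + k + (k - (t + 1))))
          (min (k - j' + k + (t + 1)) (k - j' + k + (k - (t + 1))))))
      rw [Finset.mem_insert, not_or] at hz
      have huz : u ≠ z := fun h => hz.2 (h ▸ hu)
      exact pt_mem_update hk1 huz (hS z hz.2) (by omega) le_rfl htk.le htk
        (dist_top_of_common hk1 hub huz hz.1 hj' htk)
    · rw [not_or] at hua
      have hcard := Finset.card_insert_le a (insert b W)
      have hcard' := Finset.card_insert_le b W
      have hmem : ∀ z ∉ insert a (insert b W), z ≠ a ∧ z ≠ b ∧ z ∉ W ∧ u ≠ z := by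
        intro z hz
        rw [Finset.mem_insert, Finset.mem_insert, not_or, not_or] at hz
        exact ⟨hz.1, hz.2.1, hz.2.2, fun h => hz.2.2 (h ▸ hu)⟩
      refine ihB _ u (insert a (insert b W)) (t + 1) (by omega) htk
        (Finset.mem_insert_of_mem (Finset.mem_insert_of_mem hu)) (by omega)
        (fun z hz => ?_) (hret.imp (fun _ => by omega) fun hret z hz => ?_)
        (hp (k + min j (k - j) + min (t + 1) (k - (t + 1))))
      · obtain ⟨hza, hzb, hzW, huz⟩ := hmem z hz
        exact pt_mem_update hk1 huz (hS z hzW) (by omega) le_rfl htk.le htk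
          (dist_top_of_disjoint hk1 hab huz hua.1 hua.2 hza hzb hj htk)
      · obtain ⟨hza, hzb, hzW, huz⟩ := hmem z hz
        refine pt_mem_update hk1 huz (hret z hzW) (by omega) (by omega) (by omega) (by omega) ?_
        rw [dist_top_of_disjoint hk1 hab huz hua.1 hua.2 hza hzb hj (by omega)]
        omega

/-- The triangle itself: the two vertices that are not probed cannot be told apart. -/
theorem not_winsIn_triangle [Fintype V] (hV : Fintype.card V = 3) (n : ℕ) :
    ∀ (S : Set (SubdivVertex (⊤ : SimpleGraph V) 1)) (u v : V), u ≠ v → Sum.inl u ∈ S →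
      Sum.inl v ∈ S → ¬ WinsIn (subdivision ⊤ 1) n S := by
  classical
  have : Nonempty V := Fintype.card_pos_iff.1 (by omega)
  induction n with
  | zero => exact fun S u v huv hu hv h => huv (Sum.inl.inj (h hu hv))
  | succ n ih =>
    rintro S u v huv hu hv (h | ⟨p, hp⟩)
    · exact huv (Sum.inl.inj (h hu hv))
    obtain ⟨c, rfl⟩ : ∃ c, p = Sum.inl c := by
      rcases exists_eq_pt le_rfl p with hc | ⟨a, b, j, -, h0, h1, -⟩
      · exact hc
      · omega
    obtain ⟨x, hx, y, hy, hxy⟩ := Finset.one_lt_card.1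
      (show 1 < ({c}ᶜ : Finset V).card by rw [Finset.card_compl, Finset.card_singleton]; omega)
    have hmem : ∀ x ∈ ({c}ᶜ : Finset V),
        Sum.inl x ∈ update (subdivision (⊤ : SimpleGraph V) 1) S (Sum.inl c) 1 := by
      intro x hx
      rw [Finset.mem_compl, Finset.mem_singleton] at hx
      refine ⟨⟨_, hu, ?_⟩, ?_⟩
      · by_cases hxu : x = u
        · exact Or.inl (congrArg _ hxu)
        · have hadj : (⊤ : SimpleGraph V).Adj u x := Ne.symm hxu
          have := subdivision_adj_pt (m := 1) le_rfl hadj Nat.zero_lt_one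
          rw [pt_zero le_rfl, Nat.zero_add, pt_self le_rfl hadj] at this
          exact Or.inr this
      · rw [dist_inl_inl le_rfl SimpleGraph.connected_top, SimpleGraph.dist_top_of_ne (Ne.symm hx)]
    exact ih _ x y hxy (hmem x hx) (hmem y hy) (hp 1)

theorem not_locatable_top [Fintype V] (hV : Fintype.card V = 2 * k + 1) (hk : 1 ≤ k) :
    ¬ Locatable (subdivision (⊤ : SimpleGraph V) k) := by
  intro h
  obtain ⟨N, hN⟩ := h.exists_winsIn
  obtain ⟨u, v, huv⟩ := Fintype.exists_pair_of_one_lt_card (show 1 < Fintype.card V by omega)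
  rcases hk.eq_or_lt with rfl | hk
  · exact not_winsIn_triangle hV N Set.univ u v huv trivial trivial hN
  · exact (not_winsIn_top hV hk N).1 Set.univ u v huv trivial trivial hN

end Complete

end RobberLocating

theorem theorem1 :
    (∀ (V : Type*) [Finite V] (G : SimpleGraph V), G.Connected →
      ∀ M : G.Subgraph, RobberLocating.IsMaximalMatching M →
        ∀ k m : ℕ, M.edgeSet.ncard = k → k + 1 ≤ m → 12 ≤ m →
          RobberLocating.Locatable (RobberLocating.subdivision G m)) ∧
    (∀ k : ℕ, 1 ≤ k →
      (∃ M : (⊤ : SimpleGraph (Fin (2 * k + 1))).Subgraph,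
        RobberLocating.IsMaximalMatching M ∧ M.edgeSet.ncard = k) ∧
      ¬ RobberLocating.Locatable
        (RobberLocating.subdivision (⊤ : SimpleGraph (Fin (2 * k + 1))) k)) := by
  refine ⟨fun V _ G hG M hM k m hk hkm hm => ?_, fun k hk => ⟨⟨_,
    RobberLocating.isMaximalMatching_consecutivePairs k,
    RobberLocating.ncard_edgeSet_consecutivePairs k⟩,
    RobberLocating.not_locatable_top (Fintype.card_fin _) hk⟩⟩
  obtain ⟨P, hP, hcard⟩ := hM.exists_isMaximalPairing
  exact hP.locatable hm (by omega) hG
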